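/- In the $k$-Dimensional Matching problem ($k\ge 2$) the input is a $k$-uniform hypergraph whose $n$ vertices are partitioned into $k$ parts $V_1,\dots,V_k$ of equal size, with edges $E\subseteq V_1\times\cdots\times V_k$ (one vertex from each part), and the question is whether there is a set $S\subseteq E$ of pairwise disjoint edges that covers all vertices. There is a Monte Carlo algorithm (a program for a random access machine with fair coin tosses, whose time and space are measured in bits) that takes $k$, the part size and the list of edges as input, and decides this problem as follows: if there is no such $S$ it always answers "No"; if there is one it answers "Yes" with probability at least $1-2^{-n}$; and for all outcomes of the coin tosses it halts in time $O^*\!\left(2^{n(k-2)/k}\right)$ and polynomial space. More precisely: (1) for every fixed $k\ge 2$ there is a polynomial $p_k$ such that on all instances with $n$ vertices the running time is at most $p_k(n)\,2^{n(k-2)/k}$ and the space is at most $p_k(n)$; (2) there is a single polynomial $p$ such that for all $k\ge 2$, and also if edges may be repeated in $E$, the running time is at most $p(n+k+|E|)\,2^{n(k-2)/k}$ and the space is at most $p(n+k+|E|)$. -/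

import Mathlib

/-! ### A randomized random access machine with logarithmic costs

The memory is an array of integers, almost all of them zero, with indirect addressing. Programs are
structured (assignments, conditionals, loops), may toss fair coins, and are charged for the lengths
in bits of all numbers and addresses they handle. -/

namespace RAM

/-- Memory contents: cell `a` holds the integer `μ a`; all but finitely many cells hold `0`. -/
abbrev Mem : Type := ℕ →₀ ℤ

/-- The arithmetic operations: `div` and `mod` are integer division with remainder,
`lt` returns `1` if the first argument is smaller than the second one and `0` otherwise. -/
inductive Op : Type
  | add | sub | mul | div | mod | lt

/-- The value of an arithmetic operation. -/
def Op.apply : Op → ℤ → ℤ → ℤ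
  | .add, x, y => x + y
  | .sub, x, y => x - y
  | .mul, x, y => x * y
  | .div, x, y => x / y
  | .mod, x, y => x % y
  | .lt, x, y => if x < y then 1 else 0

/-- Expressions: integer constants, the contents of the cell whose address is the value of an
expression (indirect addressing), and arithmetic operations. -/
inductive Expr : Type
  | const (c : ℤ)
  | read (a : Expr)
  | op (o : Op) (x y : Expr)

/-- The value of an expression. A negative address refers to cell `0`. -/
def Expr.eval (μ : Mem) : Expr → ℤ
  | .const c => c
  | .read a => μ (a.eval μ).toNat
  | .op o x y => o.apply (x.eval μ) (y.eval μ)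

/-- The length of an integer in bits (the sign is accounted for in the costs). -/
def len (z : ℤ) : ℕ := z.natAbs.size

/-- The cost of evaluating an expression: reading a cell costs the lengths of its address and of
its contents, and an arithmetic operation costs the product of the lengths of its arguments
(as the schoolbook methods do). -/
def Expr.cost (μ : Mem) : Expr → ℕ
  | .const c => 1 + len c
  | .read a => a.cost μ + (1 + len (a.eval μ) + len (μ (a.eval μ).toNat))
  | .op _ x y => x.cost μ + y.cost μ + (1 + len (x.eval μ)) * (1 + len (y.eval μ))

/-- The number of bits that the memory occupies: the lengths of the addresses and of the contents
of all nonzero cells. -/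
def memSize (μ : Mem) : ℕ := ∑ a ∈ μ.support, (1 + len a + len (μ a))

/-- Programs. `assign a e` stores the value of `e` in the cell with address `a`, `flip a` stores
there the outcome (`0` or `1`) of a fresh fair coin toss, and the guards of `ite` and `loop`
(a while loop) hold if their value is not zero. -/
inductive Prog : Type
  | skip
  | assign (a e : Expr)
  | flip (a : Expr)
  | seq (p q : Prog)
  | ite (g : Expr) (p q : Prog)
  | loop (g : Expr) (p : Prog)

/-- `Exec P μ ω μ' ω' t s`: started on the memory contents `μ` and with the outcomes `ω` of the
coin tosses to come, `P` halts with the memory contents `μ'` and the unused coin tosses `ω'`,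
in time `t`, and its memory and the evaluation of its expressions never take more than
the space `s`. A program that needs a coin toss when none is left does not halt. -/
inductive Exec : Prog → Mem → List Bool → Mem → List Bool → ℕ → ℕ → Prop
  | skip (μ : Mem) (ω : List Bool) : Exec .skip μ ω μ ω 1 (memSize μ)
  | assign (a e : Expr) (μ : Mem) (ω : List Bool) :
      Exec (.assign a e) μ ω (μ.update (a.eval μ).toNat (e.eval μ)) ω
        (a.cost μ + e.cost μ + (1 + len (a.eval μ) + len (e.eval μ)))
        (max (memSize μ + a.cost μ + e.cost μ)
          (memSize (μ.update (a.eval μ).toNat (e.eval μ))))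
  | flip (a : Expr) (μ : Mem) (b : Bool) (ω : List Bool) :
      Exec (.flip a) μ (b :: ω) (μ.update (a.eval μ).toNat (if b then 1 else 0)) ω
        (a.cost μ + (2 + len (a.eval μ)))
        (max (memSize μ + a.cost μ)
          (memSize (μ.update (a.eval μ).toNat (if b then 1 else 0))))
  | seq {p q : Prog} {μ μ₁ μ₂ : Mem} {ω ω₁ ω₂ : List Bool} {t₁ t₂ s₁ s₂ : ℕ}
      (hp : Exec p μ ω μ₁ ω₁ t₁ s₁) (hq : Exec q μ₁ ω₁ μ₂ ω₂ t₂ s₂) :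
      Exec (.seq p q) μ ω μ₂ ω₂ (t₁ + t₂) (max s₁ s₂)
  | ite_true {g : Expr} {p q : Prog} {μ μ₁ : Mem} {ω ω₁ : List Bool} {t s : ℕ}
      (hg : g.eval μ ≠ 0) (hp : Exec p μ ω μ₁ ω₁ t s) :
      Exec (.ite g p q) μ ω μ₁ ω₁ (g.cost μ + t) (max (memSize μ + g.cost μ) s)
  | ite_false {g : Expr} {p q : Prog} {μ μ₁ : Mem} {ω ω₁ : List Bool} {t s : ℕ}
      (hg : g.eval μ = 0) (hq : Exec q μ ω μ₁ ω₁ t s) :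
      Exec (.ite g p q) μ ω μ₁ ω₁ (g.cost μ + t) (max (memSize μ + g.cost μ) s)
  | loop_done {g : Expr} {p : Prog} {μ : Mem} {ω : List Bool} (hg : g.eval μ = 0) :
      Exec (.loop g p) μ ω μ ω (g.cost μ) (memSize μ + g.cost μ)
  | loop_step {g : Expr} {p : Prog} {μ μ₁ μ₂ : Mem} {ω ω₁ ω₂ : List Bool} {t₁ t₂ s₁ s₂ : ℕ}
      (hg : g.eval μ ≠ 0) (hp : Exec p μ ω μ₁ ω₁ t₁ s₁)
      (hl : Exec (.loop g p) μ₁ ω₁ μ₂ ω₂ t₂ s₂) :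
      Exec (.loop g p) μ ω μ₂ ω₂ (g.cost μ + t₁ + t₂)
        (max (memSize μ + g.cost μ) (max s₁ s₂))

/-- The run of a program is determined by its input and by the outcomes of its coin tosses. -/
theorem Exec.deterministic {P : Prog} {μ μ₁ μ₂ : Mem} {ω ω₁ ω₂ : List Bool} {t₁ t₂ s₁ s₂ : ℕ}
    (h₁ : Exec P μ ω μ₁ ω₁ t₁ s₁) (h₂ : Exec P μ ω μ₂ ω₂ t₂ s₂) :
    μ₁ = μ₂ ∧ ω₁ = ω₂ ∧ t₁ = t₂ ∧ s₁ = s₂ := by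
  induction h₁ generalizing μ₂ ω₂ t₂ s₂ with
  | skip => cases h₂; simp
  | assign => cases h₂; simp
  | flip => cases h₂; simp
  | seq _ _ ihp ihq =>
    cases h₂ with
    | seq hp hq =>
      obtain ⟨rfl, rfl, rfl, rfl⟩ := ihp hp
      obtain ⟨rfl, rfl, rfl, rfl⟩ := ihq hq
      simp
  | ite_true hg _ ih =>
    cases h₂ with
    | ite_true _ hp => obtain ⟨rfl, rfl, rfl, rfl⟩ := ih hp; simp
    | ite_false hg' _ => exact absurd hg' hg
  | ite_false hg _ ih =>
    cases h₂ with
    | ite_true hg' _ => exact absurd hg hg'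
    | ite_false _ hp => obtain ⟨rfl, rfl, rfl, rfl⟩ := ih hp; simp
  | loop_done hg =>
    cases h₂ with
    | loop_done => simp
    | loop_step hg' => exact absurd hg hg'
  | loop_step hg _ _ ihp ihl =>
    cases h₂ with
    | loop_done hg' => exact absurd hg' hg
    | loop_step _ hp hl =>
      obtain ⟨rfl, rfl, rfl, rfl⟩ := ihp hp
      obtain ⟨rfl, rfl, rfl, rfl⟩ := ihl hl
      simp

/-- The initial memory contents: the input is written in the cells `0, 1, 2, …`. -/
def initMem (x : List ℤ) : Mem := x.toFinsupp

/-- On the input `x` and the coin tosses `ω`, the program halts within the given time and space. -/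
def HaltsWithin (P : Prog) (x : List ℤ) (ω : List Bool) (time space : ℝ) : Prop :=
  ∃ (μ' : Mem) (ω' : List Bool) (t s : ℕ),
    Exec P (initMem x) ω μ' ω' t s ∧ (t : ℝ) ≤ time ∧ (s : ℝ) ≤ space

/-- On the input `x` and the coin tosses `ω`, the program halts and answers "Yes", which means that
it leaves a nonzero number in cell `0`; a program that leaves `0` there answers "No". -/
def AnswersYes (P : Prog) (x : List ℤ) (ω : List Bool) : Prop :=
  ∃ (μ' : Mem) (ω' : List Bool) (t s : ℕ), Exec P (initMem x) ω μ' ω' t s ∧ μ' 0 ≠ 0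

/-- The probability of an event that depends on `R` independent fair coin tosses. -/
noncomputable def coinProb {R : ℕ} (A : Set (Fin R → Bool)) : ℝ := (A.ncard : ℝ) / 2 ^ R

/-- `P` is a Monte Carlo algorithm which, on the input `x`, correctly decides whether `answer`
holds: it uses some bounded number `R` of coin tosses, halts within the given time and space for
all outcomes of them, never answers "Yes" if the answer is "No", and fails to answer "Yes" with at
most the given probability if the answer is "Yes". -/
def MonteCarloDecides (P : Prog) (x : List ℤ) (answer : Prop) (time space failure : ℝ) : Prop :=
  ∃ R : ℕ,
    (∀ ω : Fin R → Bool, HaltsWithin P x (List.ofFn ω) time space) ∧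
    (¬ answer → ∀ ω : Fin R → Bool, ¬ AnswersYes P x (List.ofFn ω)) ∧
    (answer → coinProb {ω : Fin R → Bool | ¬ AnswersYes P x (List.ofFn ω)} ≤ failure)

end RAM

/-! ### `k`-Dimensional Matching

The vertices are the pairs `(j, v)` with `j : Fin k` and `v : Fin q`; the `j`-th part consists of
the `q` vertices with first component `j`. An edge is a `k`-tuple with one vertex of each part. -/

namespace KDM

/-- The set of vertices of an edge. -/
def edgeSet {k q : ℕ} (e : Fin k → Fin q) : Finset (Fin k × Fin q) :=
  Finset.univ.image fun j => (j, e j)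

/-- Some set `S` of pairwise disjoint edges from `E` covers all vertices. -/
def HasPerfectMatching {k q : ℕ} (E : List (Fin k → Fin q)) : Prop :=
  ∃ S : Finset (Fin k → Fin q), (∀ e ∈ S, e ∈ E) ∧
    S.biUnion edgeSet = Finset.univ ∧
    ∀ e₁ ∈ S, ∀ e₂ ∈ S, e₁ ≠ e₂ → Disjoint (edgeSet e₁) (edgeSet e₂)

/-- An instance as a list of numbers: `k`, the size `q` of the parts, the number of edges, and
then the edges one after the other, each as the list of its `k` entries. -/
def encode {k q : ℕ} (E : List (Fin k → Fin q)) : List ℤ :=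
  [(k : ℤ), (q : ℤ), (E.length : ℤ)] ++
    E.flatMap fun e => List.ofFn fun j => (((e j : Fin q) : ℕ) : ℤ)

/-- On the instance with the edges `E`, on `n = k * q` vertices, `P` decides whether there is a
perfect matching, in time `B * 2 ^ (n * (k - 2) / k)` and space `B`, with a probability of failure
of at most `2 ^ (-n)`. -/
def DecidedBy (P : RAM.Prog) {k q : ℕ} (E : List (Fin k → Fin q)) (B : ℕ) : Prop :=
  RAM.MonteCarloDecides P (encode E) (HasPerfectMatching E)
    ((B : ℝ) * (2 : ℝ) ^ (((k * q : ℕ) : ℝ) * ((k : ℝ) - 2) / (k : ℝ)))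
    (B : ℝ)
    ((2 : ℝ) ^ (-((k * q : ℕ) : ℝ)))

end KDM

/-! ### The Faddeev–LeVerrier algorithm -/

namespace Leverrier

open Polynomial Matrix

/-! Write `k = κ + 2` and give every edge an integer weight. Choose signs for the `κ * q` vertices
outside the first two parts, multiply the weight of each edge by the signs of its vertices there,
and collect these signed weights in a `q × q` matrix indexed by the vertices in the first two parts.
By Leibniz's formula its determinant is a sum over choices of `q` edges that cover each of the first
two parts exactly once. Multiplying by the product of all signs and summing over all choices of
signs cancels every family that meets some remaining vertex an even number of times. If `q` edges
meet each of the `q` vertices of a part an odd number of times, they meet each exactly once; so only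
perfect matchings survive (`sum_prod_bitSign`, `detSum_eq`).

A matching can be recovered from its set of edges (`IsMatching.unique`), so different matchings
contribute different monomials and nothing cancels (`detSum_indicator`). The signed sum is thus a
polynomial of degree at most `q` in the weights. It vanishes identically if there is no perfect
matching, which makes the error one-sided (`detSum_eq_zero`). Otherwise random weights of `k * q +
q` bits make it vanish with probability at most `q / 2 ^ (k * q + q) ≤ 2 ^ (-k * q)` by
Schwartz–Zippel (`coinProb_le`).

There are `2 ^ (κ * q) = 2 ^ (n * (k - 2) / k)` choices of signs, run through one after the other in
the same memory. The determinants come from the Faddeev–LeVerrier recursion, whose divisions are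
exact over `ℤ` and whose numbers have polynomial length (`state_last`, `abs_state_le`).

For the machine it suffices to count elementary steps and to bound the numbers: the expressions in
the program have bounded size, so as long as all numbers fit into `width` bits, a step costs at most
`stepTime width`. The predicate `Wp` does this accounting, and `sum_maskTerm` identifies the
computed number with the signed sum. -/

theorem derivative_det {n : Type*} [DecidableEq n] [Fintype n] {R : Type*} [CommRing R]
    (N : Matrix n n R[X]) :
    derivative N.det = ∑ i, (N.updateCol i fun j => derivative (N j i)).det := by
  simp only [Matrix.det_apply', derivative_sum]
  rw [Finset.sum_comm]
  refine Finset.sum_congr rfl fun σ _ => ?_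
  rw [← Finset.mul_sum, derivative_intCast_mul, derivative_prod_finset]
  · refine congrArg _ (Finset.sum_congr rfl fun i _ => ?_)
    rw [← Finset.mul_prod_erase _ _ (Finset.mem_univ i), mul_comm]
    congr 1
    · simp
    · refine Finset.prod_congr rfl fun j hj => ?_
      rw [Matrix.updateCol_ne (Finset.ne_of_mem_erase hj)]

/-- Differentiating column `i` of `X - A` leaves the `i`-th unit vector, and the determinant with
that column is the `i`-th diagonal cofactor. -/
theorem derivative_charpoly {n : Type*} [DecidableEq n] [Fintype n] {R : Type*} [CommRing R]
    (A : Matrix n n R) : derivative A.charpoly = (adjugate A.charmatrix).trace := by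
  rw [Matrix.charpoly, derivative_det, Matrix.trace]
  refine Finset.sum_congr rfl fun i _ => ?_
  rw [Matrix.diag_apply, ← Matrix.transpose_apply (adjugate _), Matrix.adjugate_transpose,
    Matrix.adjugate_apply, Matrix.updateRow_transpose, Matrix.det_transpose]
  congr 2
  ext j : 1
  rcases eq_or_ne j i with rfl | h
  · simp
  · simp [h]

/-! ### The recursion for the coefficients of the adjugate -/

variable {q : ℕ} (A : Matrix (Fin q) (Fin q) ℤ)

/-- The coefficients of the adjugate of the characteristic matrix. -/
noncomputable def adjCoeff (j : ℕ) : Matrix (Fin q) (Fin q) ℤ :=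
  (matPolyEquiv (adjugate A.charmatrix)).coeff j

/-- This is `M * adj M = det M`, read in polynomials with matrix coefficients, where coefficients
can be compared. -/
theorem charmatrix_mul_adj :
    (X - C A) * matPolyEquiv (adjugate A.charmatrix) =
      A.charpoly.map (algebraMap ℤ (Matrix (Fin q) (Fin q) ℤ)) := by
  rw [← matPolyEquiv_charmatrix, ← map_mul, Matrix.mul_adjugate, matPolyEquiv_smul_one]
  rfl

theorem adjCoeff_step (j : ℕ) :
    adjCoeff A j = A * adjCoeff A (j + 1) + (A.charpoly.coeff (j + 1)) • (1 : Matrix _ _ ℤ) := by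
  have h := congrArg (fun P => P.coeff (j + 1)) (charmatrix_mul_adj A)
  simp only [sub_mul, coeff_sub, coeff_X_mul, coeff_C_mul, coeff_map] at h
  rw [Algebra.algebraMap_eq_smul_one] at h
  rw [← h, adjCoeff, adjCoeff]
  abel

theorem adjCoeff_zero :
    A * adjCoeff A 0 = - (A.charpoly.coeff 0) • (1 : Matrix _ _ ℤ) := by
  have h := congrArg (fun P => P.coeff 0) (charmatrix_mul_adj A)
  simp only [sub_mul, coeff_sub, coeff_X_mul_zero, coeff_C_mul, coeff_map] at h
  rw [Algebra.algebraMap_eq_smul_one] at h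
  rw [neg_smul, ← h, adjCoeff]
  abel

theorem trace_adjCoeff (j : ℕ) :
    (adjCoeff A j).trace = A.charpoly.coeff (j + 1) * (j + 1) := by
  rw [← coeff_derivative, derivative_charpoly, Matrix.trace, Matrix.trace, finsetSum_coeff]
  refine Finset.sum_congr rfl fun i _ => ?_
  simp [adjCoeff, matPolyEquiv_coeff_apply]

theorem adjCoeff_eq_zero (j : ℕ) (hj : q ≤ j) : adjCoeff A j = 0 := by
  obtain ⟨d, hd⟩ : ∃ d, ∀ i, d ≤ i → adjCoeff A i = 0 :=
    ⟨(matPolyEquiv (adjugate A.charmatrix)).natDegree + 1, fun i hi =>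
      coeff_eq_zero_of_natDegree_lt hi⟩
  -- Downward induction from the degree of the adjugate: above `q`, the recursion has no
  -- contribution from the characteristic polynomial. Here `e` bounds the distance from `i` up to
  -- `d`.
  have key : ∀ e i, q ≤ i → d ≤ i + e → adjCoeff A i = 0 := by
    intro e
    induction e with
    | zero => intro i _ h; exact hd i h
    | succ e ih =>
      intro i hi h
      rw [adjCoeff_step, ih (i + 1) (by omega) (by omega), coeff_eq_zero_of_natDegree_lt]
      · simp
      · rw [Matrix.charpoly_natDegree_eq_dim]; simp; omega
  exact key d j hj (by omega)

/-- With `j = q - 1 - t`, the trace of the recursion is `j * c = tr + q * c`, so `tr = (j - q) * c`.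
This is why the division by `t + 1` in `state` is exact. -/
theorem trace_mul_adjCoeff (t : ℕ) (ht : t < q) :
    (A * adjCoeff A (q - 1 - t)).trace = - ((t + 1 : ℤ) * A.charpoly.coeff (q - 1 - t)) := by
  rcases Nat.eq_zero_or_pos (q - 1 - t) with h | h
  -- In the last round there is no preceding coefficient; the constant terms are compared instead.
  · rw [h, adjCoeff_zero, Matrix.trace_smul, Matrix.trace_one]
    have : (q : ℤ) = t + 1 := by omega
    simp [this]; ring
  · obtain ⟨j, hj⟩ : ∃ j, q - 1 - t = j + 1 := ⟨q - 1 - t - 1, by omega⟩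
    have h1 := trace_adjCoeff A j
    rw [adjCoeff_step, Matrix.trace_add, Matrix.trace_smul, Matrix.trace_one] at h1
    rw [hj]
    have : (q : ℤ) = t + 1 + (j + 1) := by omega
    simp only [Fintype.card_fin, smul_eq_mul, this] at h1
    linarith

/-- The pair of the current matrix and of the current coefficient after `t` rounds. -/
def state (q : ℕ) (a : ℕ → ℕ → ℤ) : ℕ → (ℕ → ℕ → ℤ) × ℤ
  | 0 => (fun r s => if r = s then 1 else 0, 1)
  | t + 1 =>
    let T : ℕ → ℕ → ℤ := fun r s => ∑ l ∈ Finset.range q, a r l * (state q a t).1 l s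
    let c : ℤ := (- ∑ r ∈ Finset.range q, T r r) / ((t : ℤ) + 1)
    (fun r s => T r s + (if r = s then 1 else 0) * c, c)

/-- The loop invariant of the recursion. The matrix is only described for `t < q`, because at `t =
q` the index `q - 1 - t` would be truncated to `0`. -/
theorem state_eq (a : ℕ → ℕ → ℤ) (hA : ∀ i j, A i j = a i j) (t : ℕ) (ht : t ≤ q) :
    (state q a t).2 = A.charpoly.coeff (q - t) ∧
      (t < q → ∀ r s : Fin q, (state q a t).1 r s = adjCoeff A (q - 1 - t) r s) := by
  induction t with
  | zero =>
    have h1 : A.charpoly.coeff q = 1 := by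
      have := Matrix.charpoly_monic A
      rw [Monic, leadingCoeff, Matrix.charpoly_natDegree_eq_dim] at this
      simpa using this
    refine ⟨by simp [state, h1], fun hq r s => ?_⟩
    rw [adjCoeff_step, adjCoeff_eq_zero _ _ (by omega), show q - 1 - 0 + 1 = q by omega, h1]
    simp [state, Matrix.one_apply, Fin.ext_iff]
  | succ t ih =>
    obtain ⟨-, ih⟩ := ih (by omega)
    replace ih := ih (by omega)
    have hT : ∀ r s : Fin q, ∑ l ∈ Finset.range q, a r l * (state q a t).1 l s =
        (A * adjCoeff A (q - 1 - t)) r s := by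
      intro r s
      rw [Matrix.mul_apply, Finset.sum_range]
      exact Finset.sum_congr rfl fun l _ => by rw [ih, hA]
    have hc : (state q a (t + 1)).2 = A.charpoly.coeff (q - (t + 1)) := by
      rw [state, Finset.sum_range]
      simp only [hT]
      have := trace_mul_adjCoeff A t (by omega)
      rw [Matrix.trace] at this
      simp only [Matrix.diag_apply] at this
      rw [this, neg_neg, Int.mul_ediv_cancel_left _ (by omega), show q - (t + 1) = q - 1 - t by omega]
    refine ⟨hc, fun hq r s => ?_⟩
    rw [adjCoeff_step, show q - 1 - (t + 1) + 1 = q - (t + 1) by omega, ← hc, Matrix.add_apply,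
      show q - (t + 1) = q - 1 - t by omega, ← hT]
    simp [state, Matrix.one_apply, Fin.ext_iff]

theorem state_last (a : ℕ → ℕ → ℤ) :
    (state q a q).2 = (-1) ^ q * (Matrix.of fun i j : Fin q => a i j).det := by
  rw [(state_eq (Matrix.of fun i j : Fin q => a i j) a (fun _ _ => rfl) q le_rfl).1, Nat.sub_self,
    Matrix.det_eq_sign_charpoly_coeff, ← mul_assoc, Fintype.card_fin, ← mul_pow]
  simp

/-- One round multiplies the bound by at most `q * b + q ^ 2 * b`, since integer division does not
increase absolute values. The crude base is enough: it gives numbers of polynomial length. -/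
theorem abs_state_le (a : ℕ → ℕ → ℤ) (b : ℤ) (hb : 1 ≤ b) (ha : ∀ i < q, ∀ j < q, |a i j| ≤ b) (t : ℕ) :
    (∀ r < q, ∀ s < q, |(state q a t).1 r s| ≤ (2 * q ^ 2 * b + 1) ^ t) ∧
      |(state q a t).2| ≤ (2 * q ^ 2 * b + 1) ^ t := by
  induction t with
  | zero =>
    refine ⟨fun r _ s _ => ?_, by simp [state]⟩
    simp only [state]; split_ifs <;> simp
  | succ t ih =>
    obtain ⟨ih, -⟩ := ih
    set D : ℤ := (2 * q ^ 2 * b + 1) ^ t with hD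
    have hD0 : 0 ≤ D := by positivity
    have hT : ∀ r < q, ∀ s < q, |∑ l ∈ Finset.range q, a r l * (state q a t).1 l s| ≤ q * b * D := by
      intro r hr s hs
      refine (Finset.abs_sum_le_sum_abs _ _).trans ?_
      refine (Finset.sum_le_card_nsmul _ _ (b * D) fun l hl => ?_).trans_eq (by simp; ring)
      rw [abs_mul]
      exact mul_le_mul (ha _ hr _ (Finset.mem_range.1 hl)) (ih _ (Finset.mem_range.1 hl) _ hs) (abs_nonneg _) (by positivity)
    have hc : |(state q a (t + 1)).2| ≤ q ^ 2 * b * D := by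
      simp only [state]
      refine (Int.abs_ediv_le_abs _ _).trans ?_
      rw [abs_neg]
      refine (Finset.abs_sum_le_sum_abs _ _).trans ?_
      refine (Finset.sum_le_card_nsmul _ _ _ fun l hl =>
        hT _ (Finset.mem_range.1 hl) _ (Finset.mem_range.1 hl)).trans_eq (by simp; ring)
    have hq : (q : ℤ) ≤ q ^ 2 := by exact_mod_cast Nat.le_self_pow two_ne_zero q
    have hbD : 0 ≤ b * D := by positivity
    rw [pow_succ, ← hD]
    refine ⟨fun r hr s hs => ?_, hc.trans (by nlinarith)⟩
    have h2 : |(if r = s then 1 else 0) * (state q a (t + 1)).2| ≤ q ^ 2 * b * D := by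
      split_ifs
      · simpa using hc
      · simp only [zero_mul, abs_zero]; positivity
    calc |(state q a (t + 1)).1 r s| ≤ q * b * D + q ^ 2 * b * D :=
          (abs_add_le _ _).trans (add_le_add (hT r hr s hs) h2)
      _ ≤ D * (2 * q ^ 2 * b + 1) := by nlinarith

end Leverrier

/-! ### A determinant sum that detects perfect matchings -/

namespace KDM

open Finset

section DetSum

variable {κ q m : ℕ} {R : Type*} [CommRing R]

/-- The sign of a bit. -/
def bitSign (x : Fin 2) : R := 1 - 2 * ((x : ℕ) : R)

/-- Orthogonality of the characters of a group of order two, used as a parity test for one vertex.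
-/
theorem sum_bitSign_pow (d : ℕ) :
    ∑ x : Fin 2, (bitSign x : R) * bitSign x ^ d = if Odd d then 2 else 0 := by
  rw [Fin.sum_univ_two]
  simp only [bitSign, Fin.val_zero, Fin.val_one, Nat.cast_zero, Nat.cast_one]
  split_ifs with h
  · rw [show (1 - 2 * 1 : R) = -1 by ring, h.neg_one_pow]; norm_num
  · rw [show (1 - 2 * 1 : R) = -1 by ring, (Nat.not_odd_iff_even.1 h).neg_one_pow]; norm_num

/-- The sum factors over the vertices, and each factor tests whether its vertex is hit an odd number
of times. If all are, then `g · l` is surjective, hence bijective because source and target both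
have `q` elements. -/
theorem sum_prod_bitSign (g : Fin q → Fin κ → Fin q) :
    ∑ s : Fin κ × Fin q → Fin 2, (∏ b, (bitSign (s b) : R)) * ∏ i, ∏ l, bitSign (s (l, g i l)) =
      if ∀ l, Function.Bijective fun i => g i l then 2 ^ (κ * q) else 0 := by
  classical
  have h1 : ∀ s : Fin κ × Fin q → Fin 2, ∏ i, ∏ l, (bitSign (s (l, g i l)) : R) =
      ∏ b : Fin κ × Fin q, bitSign (s b) ^ #{i | g i b.1 = b.2} := by
    intro s
    rw [Finset.prod_comm, Fintype.prod_prod_type]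
    refine prod_congr rfl fun l _ => ?_
    rw [← Finset.prod_fiberwise' univ (fun i => g i l) (fun v => (bitSign (s (l, v)) : R))]
    exact prod_congr rfl fun v _ => by rw [prod_const]
  simp only [h1, ← prod_mul_distrib]
  rw [← Fintype.piFinset_univ, ← Finset.prod_univ_sum (fun _ => univ)
    (fun (b : Fin κ × Fin q) x => (bitSign x : R) * bitSign x ^ #{i | g i b.1 = b.2})]
  simp only [sum_bitSign_pow]
  split_ifs with h
  · rw [prod_congr rfl fun b _ => if_pos _, prod_const]
    · simp
    · rintro ⟨l, v⟩ -
      obtain ⟨i, hi, hu⟩ := (h l).existsUnique v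
      rw [show ({j | g j l = v} : Finset (Fin q)) = {i} by ext j; simpa using ⟨hu j, by rintro rfl; exact hi⟩]
      simp
  · obtain ⟨b, hb⟩ : ∃ b : Fin κ × Fin q, ¬ Odd #{i | g i b.1 = b.2} := by
      by_contra! hc
      refine h fun l => Finite.surjective_iff_bijective.1 fun v => ?_
      obtain ⟨i, hi⟩ := card_pos.1 (hc (l, v)).pos
      exact ⟨i, by simpa using hi⟩
    exact prod_eq_zero (mem_univ b) (if_neg hb)

/-- The sum of the signed weights of the edges through two given vertices. -/
def signedMatrix (E : Fin m → Fin (κ + 2) → Fin q) (w : Fin m → R) (s : Fin κ × Fin q → Fin 2) :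
    Matrix (Fin q) (Fin q) R :=
  Matrix.of fun i j => ∑ e, if E e 0 = i ∧ E e 1 = j then
    w e * ∏ l : Fin κ, bitSign (s (l, E e l.succ.succ)) else 0

/-- The signed sum of the determinants. -/
def detSum (E : Fin m → Fin (κ + 2) → Fin q) (w : Fin m → R) : R :=
  ∑ s : Fin κ × Fin q → Fin 2, (∏ b, bitSign (s b)) * (signedMatrix E w s).det

/-- The edges `φ j` form a perfect matching; `φ j` passes through `σ j` in the first part and
through `j` in the second one. -/
def IsMatching (E : Fin m → Fin (κ + 2) → Fin q) (σ : Equiv.Perm (Fin q)) (φ : Fin q → Fin m) :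
    Prop :=
  (∀ i, E (φ i) 0 = σ i ∧ E (φ i) 1 = i) ∧ ∀ l : Fin κ, Function.Bijective fun i => E (φ i) l.succ.succ

-- Expanding the determinant and the sums in its entries selects an edge `φ i` for each column `i`.
-- The permutation takes care of the first two parts, and `sum_prod_bitSign` filters the others.
open Classical in
theorem detSum_eq (E : Fin m → Fin (κ + 2) → Fin q) (w : Fin m → R) :
    detSum E w = 2 ^ (κ * q) * ∑ σ : Equiv.Perm (Fin q), ∑ φ : Fin q → Fin m,
      if IsMatching E σ φ then ((Equiv.Perm.sign σ : ℤ) : R) * ∏ i, w (φ i) else 0 := by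
  have h1 : ∀ s, (signedMatrix E w s).det = ∑ σ : Equiv.Perm (Fin q), ∑ φ : Fin q → Fin m,
      if ∀ i, E (φ i) 0 = σ i ∧ E (φ i) 1 = i then ((Equiv.Perm.sign σ : ℤ) : R) * ∏ i, w (φ i) *
        ∏ l : Fin κ, bitSign (s (l, E (φ i) l.succ.succ)) else 0 := by
    intro s
    rw [Matrix.det_apply']
    refine sum_congr rfl fun σ _ => ?_
    simp only [signedMatrix, Matrix.of_apply]
    rw [Finset.prod_univ_sum, mul_sum, Fintype.piFinset_univ]
    refine sum_congr rfl fun φ _ => ?_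
    split_ifs with h
    · exact congrArg _ (prod_congr rfl fun i _ => if_pos (h i))
    · push Not at h
      obtain ⟨i, hi⟩ := h
      rw [prod_eq_zero (mem_univ i) (if_neg fun hc => hi hc.1 hc.2), mul_zero]
  simp only [detSum, h1, mul_sum]
  rw [sum_comm]
  refine sum_congr rfl fun σ _ => ?_
  rw [sum_comm]
  refine sum_congr rfl fun φ _ => ?_
  by_cases h : ∀ i, E (φ i) 0 = σ i ∧ E (φ i) 1 = i
  · simp only [if_pos h]
    have h2 := sum_prod_bitSign (R := R) fun i (l : Fin κ) => E (φ i) l.succ.succ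
    rw [show (if IsMatching E σ φ then ((Equiv.Perm.sign σ : ℤ) : R) * ∏ i, w (φ i) else 0) =
      if ∀ l : Fin κ, Function.Bijective fun i => E (φ i) l.succ.succ then
        ((Equiv.Perm.sign σ : ℤ) : R) * ∏ i, w (φ i) else 0 from if_congr (and_iff_right h) rfl rfl]
    rw [show (2 ^ (κ * q) * if ∀ l : Fin κ, Function.Bijective fun i => E (φ i) l.succ.succ then
        ((Equiv.Perm.sign σ : ℤ) : R) * ∏ i, w (φ i) else 0) =
        (((Equiv.Perm.sign σ : ℤ) : R) * ∏ i, w (φ i)) *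
        if ∀ l : Fin κ, Function.Bijective fun i => E (φ i) l.succ.succ then 2 ^ (κ * q) else 0 by
      split_ifs <;> ring, ← h2, mul_sum]
    refine sum_congr rfl fun s _ => ?_
    rw [prod_mul_distrib]
    ring
  · rw [if_neg fun hc : IsMatching E σ φ => h hc.1]
    simp [h]

/-! ### The signed sum as a polynomial in the weights -/

theorem map_detSum {S : Type*} [CommRing S] (f : R →+* S) (E : Fin m → Fin (κ + 2) → Fin q)
    (w : Fin m → R) : f (detSum E w) = detSum E fun e => f (w e) := by
  classical
  simp only [detSum_eq, map_mul, map_sum, map_pow, map_ofNat, apply_ite f, map_zero, map_prod,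
    map_intCast]

/-- An edge of a matching is identified by its vertex in the second part, so a second matching that
uses only edges of the first must use them at the same places. -/
theorem IsMatching.unique {E : Fin m → Fin (κ + 2) → Fin q} {σ σ' : Equiv.Perm (Fin q)}
    {φ φ' : Fin q → Fin m} (h : IsMatching E σ φ) (h' : IsMatching E σ' φ')
    (hr : ∀ i, φ' i ∈ Set.range φ) : σ' = σ ∧ φ' = φ := by
  have hφ : φ' = φ := by
    funext i
    obtain ⟨j, hj⟩ := hr i
    have := (h'.1 i).2
    rw [← hj, (h.1 j).2] at this
    rw [← hj, this]
  subst hφ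
  exact ⟨Equiv.ext fun i => (h'.1 i).1.symm.trans (h.1 i).1, rfl⟩

/-- Weights that are zero off one matching eliminate all others by `IsMatching.unique`; what remains
is `± 2 ^ (κ * q)`. This excludes cancellation between matchings of opposite sign. -/
theorem detSum_indicator {E : Fin m → Fin (κ + 2) → Fin q} {σ : Equiv.Perm (Fin q)}
    {φ : Fin q → Fin m} (h : IsMatching E σ φ) [DecidablePred (· ∈ Set.range φ)] :
    detSum E (fun e => if e ∈ Set.range φ then (1 : ℤ) else 0) ≠ 0 := by
  classical
  rw [detSum_eq, sum_eq_single σ, sum_eq_single φ, if_pos h, prod_congr rfl fun i _ => if_pos _]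
  · simp
  · exact fun i _ => Set.mem_range_self i
  · intro φ' _ hφ
    split_ifs with h'
    · obtain ⟨i, hi⟩ : ∃ i, φ' i ∉ Set.range φ := by
        by_contra! hc
        exact hφ (h.unique h' hc).2
      rw [prod_eq_zero (mem_univ i) (if_neg hi), mul_zero]
    · rfl
  · simp
  · intro σ' _ hσ
    refine sum_eq_zero fun φ' _ => ?_
    split_ifs with h'
    · obtain ⟨i, hi⟩ : ∃ i, φ' i ∉ Set.range φ := by
        by_contra! hc
        exact hσ (h.unique h' hc).1
      rw [prod_eq_zero (mem_univ i) (if_neg hi), mul_zero]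
    · rfl
  · simp

theorem totalDegree_detSum_X (E : Fin m → Fin (κ + 2) → Fin q) :
    (detSum E fun e => (MvPolynomial.X e : MvPolynomial (Fin m) ℤ)).totalDegree ≤ q := by
  classical
  rw [detSum_eq]
  refine (MvPolynomial.totalDegree_mul _ _).trans ?_
  rw [show ((2 : MvPolynomial (Fin m) ℤ) ^ (κ * q)) = MvPolynomial.C (2 ^ (κ * q)) by simp,
    MvPolynomial.totalDegree_C, zero_add]
  refine MvPolynomial.totalDegree_finsetSum_le fun σ _ =>
    MvPolynomial.totalDegree_finsetSum_le fun φ _ => ?_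
  split_ifs
  · refine (MvPolynomial.totalDegree_mul _ _).trans ?_
    rw [show (((Equiv.Perm.sign σ : ℤ) : MvPolynomial (Fin m) ℤ)) =
      MvPolynomial.C (Equiv.Perm.sign σ : ℤ) by simp, MvPolynomial.totalDegree_C, zero_add]
    refine (MvPolynomial.totalDegree_finsetProd _ _).trans ?_
    simp
  · simp

/-- Schwartz–Zippel for the signed sum in indeterminates, which is nonzero because evaluating it at
the indicator of the given matching yields a nonzero number. -/
theorem card_detSum_eq_zero_le {E : Fin m → Fin (κ + 2) → Fin q} {σ : Equiv.Perm (Fin q)}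
    {φ : Fin q → Fin m} (h : IsMatching E σ φ) (S : Finset ℤ) :
    (#{f ∈ Fintype.piFinset fun _ : Fin m => S | detSum E f = 0} / (#S ^ m : ℚ≥0) : ℚ≥0) ≤
      q / #S := by
  classical
  have hp : (detSum E fun e => (MvPolynomial.X e : MvPolynomial (Fin m) ℤ)) ≠ 0 := by
    intro h0
    have := map_detSum (MvPolynomial.eval fun e => if e ∈ Set.range φ then (1 : ℤ) else 0) E
      fun e => (MvPolynomial.X e : MvPolynomial (Fin m) ℤ)
    rw [h0, map_zero] at this
    simp only [MvPolynomial.eval_X] at this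
    exact detSum_indicator h this.symm
  have := MvPolynomial.schwartz_zippel_totalDegree hp S
  simp only [map_detSum, MvPolynomial.eval_X] at this
  refine this.trans ?_
  gcongr
  exact totalDegree_detSum_X E

end DetSum

/-! ### Perfect matchings as choices of an edge for each vertex of the second part -/

theorem mem_edgeSet {k q : ℕ} {e : Fin k → Fin q} {j : Fin k} {v : Fin q} :
    (j, v) ∈ edgeSet e ↔ e j = v := by
  simp [edgeSet]

/-- Covering gives an edge through every vertex of the second part, and disjointness makes the
chosen edges injective in every part. Since `φ` picks positions in the list, repeated edges do no
harm. -/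
theorem hasPerfectMatching_iff {κ q : ℕ} (E : List (Fin (κ + 2) → Fin q)) :
    HasPerfectMatching E ↔ ∃ σ φ, IsMatching E.get σ φ := by
  constructor
  · rintro ⟨S, hS, hc, hd⟩
    have h1 : ∀ i : Fin q, ∃ e ∈ S, e 1 = i := by
      intro i
      have : ((1 : Fin (κ + 2)), i) ∈ S.biUnion edgeSet := by rw [hc]; exact mem_univ _
      obtain ⟨e, he, hi⟩ := mem_biUnion.1 this
      exact ⟨e, he, mem_edgeSet.1 hi⟩
    choose e he he1 using h1
    have h2 : ∀ l, Function.Bijective fun i => e i l := by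
      refine fun l => Finite.injective_iff_bijective.1 fun i j hij => ?_
      have : e i = e j := by
        by_contra hne
        exact Finset.disjoint_left.1 (hd _ (he i) _ (he j) hne) (mem_edgeSet (j := l).2 rfl)
          (mem_edgeSet.2 hij.symm)
      rw [← he1 i, ← he1 j, this]
    have h3 : ∀ i, ∃ x, E.get x = e i := fun i => List.mem_iff_get.1 (hS _ (he i))
    choose φ hφ using h3
    refine ⟨Equiv.ofBijective _ (h2 0), φ, fun i => ?_, fun l => ?_⟩
    · simp only [hφ]; exact ⟨rfl, he1 i⟩
    · simpa only [hφ] using h2 l.succ.succ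
  · rintro ⟨σ, φ, h1, h2⟩
    have h3 : ∀ l, Function.Bijective fun i => E.get (φ i) l := by
      intro l
      refine Fin.cases ?_ (fun l => ?_) l
      · simp only [(h1 _).1]; exact σ.bijective
      · refine Fin.cases ?_ (fun l => h2 l) l
        have : ∀ i, E.get (φ i) (Fin.succ 0) = i := fun i => (h1 i).2
        simp only [this]; exact Function.bijective_id
    refine ⟨univ.image fun i => E.get (φ i), ?_, ?_, ?_⟩
    · intro e he
      obtain ⟨i, -, rfl⟩ := mem_image.1 he
      exact List.get_mem _ _
    · refine eq_univ_of_forall fun ⟨l, v⟩ => ?_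
      obtain ⟨i, hi⟩ := (h3 l).2 v
      exact mem_biUnion.2 ⟨_, mem_image_of_mem _ (mem_univ i), mem_edgeSet.2 hi⟩
    · intro e₁ h₁ e₂ h₂ hne
      obtain ⟨i, -, rfl⟩ := mem_image.1 h₁
      obtain ⟨j, -, rfl⟩ := mem_image.1 h₂
      refine Finset.disjoint_left.2 fun ⟨l, v⟩ ha hb => hne ?_
      rw [(h3 l).1 ((mem_edgeSet.1 ha).trans (mem_edgeSet.1 hb).symm)]

theorem detSum_eq_zero {κ q : ℕ} {R : Type*} [CommRing R] {E : List (Fin (κ + 2) → Fin q)}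
    (h : ¬ HasPerfectMatching E) (w : Fin E.length → R) : detSum E.get w = 0 := by
  classical
  rw [hasPerfectMatching_iff] at h
  push Not at h
  rw [detSum_eq]
  simp [h]

end KDM

/-! ### Costs of expressions and memory sizes -/

namespace RAM

theorem len_le_iff {z : ℤ} {w : ℕ} : len z ≤ w ↔ |z| < 2 ^ w := by
  rw [len, Nat.size_le, Int.abs_eq_natAbs]
  exact_mod_cast Iff.rfl

theorem len_le_natAbs (z : ℤ) : len z ≤ z.natAbs :=
  Nat.size_le.2 Nat.lt_two_pow_self

theorem len_mono {x y : ℤ} (h : x.natAbs ≤ y.natAbs) : len x ≤ len y :=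
  Nat.size_le_size h

theorem natAbs_lt_two_pow_len (x : ℤ) : x.natAbs < 2 ^ len x := Nat.lt_size_self _

theorem len_add_le (x y : ℤ) : len (x + y) ≤ len x + len y + 1 := by
  refine Nat.size_le.2 ((Int.natAbs_add_le x y).trans_lt ?_)
  have hx := natAbs_lt_two_pow_len x
  have hy := natAbs_lt_two_pow_len y
  have h1 : 2 ^ len x ≤ 2 ^ (len x + len y) := Nat.pow_le_pow_right two_pos (by omega)
  have h2 : 2 ^ len y ≤ 2 ^ (len x + len y) := Nat.pow_le_pow_right two_pos (by omega)
  rw [pow_succ]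
  omega

theorem len_neg (x : ℤ) : len (-x) = len x := by simp [len]

theorem len_apply_le (o : Op) (x y : ℤ) : len (o.apply x y) ≤ len x + len y + 1 := by
  cases o with
  | add => exact len_add_le x y
  | sub =>
    have := len_add_le x (-y)
    rwa [len_neg, ← sub_eq_add_neg] at this
  | mul =>
    refine (Nat.size_le.2 (?_ : (x * y).natAbs < 2 ^ (len x + len y))).trans (Nat.le_succ _)
    rw [Int.natAbs_mul, pow_add]
    exact Nat.mul_lt_mul'' (natAbs_lt_two_pow_len x) (natAbs_lt_two_pow_len y)
  | div =>
    refine (len_mono (y := x) ?_).trans (by omega)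
    have := Int.abs_ediv_le_abs x y
    rw [Int.abs_eq_natAbs, Int.abs_eq_natAbs] at this
    show (x / y).natAbs ≤ _
    omega
  | mod =>
    show len (x % y) ≤ _
    -- The remainder modulo `0` is `x` itself, so there the length is bounded by that of `x` rather
    -- than of `y`.
    rcases eq_or_ne y 0 with rfl | hy
    · rw [Int.emod_zero]; omega
    · refine (len_mono (y := y) ?_).trans (by omega)
      have := Int.emod_lt_abs x hy
      rw [Int.abs_eq_natAbs] at this
      have := Int.emod_nonneg x hy
      omega
  | lt =>
    show len (if x < y then 1 else 0) ≤ _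
    refine (len_le_natAbs _).trans ?_
    split_ifs <;> simp

/-! ### Costs in terms of the size of an expression and the length of the numbers -/

/-- A bound on the size of an expression, where constants count with their absolute values. -/
def Expr.weight : Expr → ℕ
  | .const c => 1 + c.natAbs
  | .read a => 1 + a.weight
  | .op _ x y => 1 + x.weight + y.weight

theorem Expr.one_le_weight (e : Expr) : 1 ≤ e.weight := by
  cases e <;> simp only [weight] <;> omega

theorem Expr.len_eval_le {μ : Mem} {w : ℕ} (h : ∀ a, len (μ a) ≤ w) (e : Expr) :
    len (e.eval μ) ≤ e.weight * (w + 1) := by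
  induction e with
  | const c =>
    exact (len_le_natAbs c).trans
      ((Nat.le_add_left _ 1).trans (Nat.le_mul_of_pos_right _ w.succ_pos))
  | read a _ => exact (h _).trans (by simp only [weight]; nlinarith)
  | op o x y hx hy =>
    refine (len_apply_le _ _ _).trans ?_
    simp only [weight]
    nlinarith

/-- An operation costs a product of two lengths, each linear in the weight. Squares are
superadditive, so the costs of subexpressions fit under the same quadratic bound. -/
theorem Expr.cost_le {μ : Mem} {w : ℕ} (h : ∀ a, len (μ a) ≤ w) (e : Expr) :
    e.cost μ ≤ 2 * (e.weight * (w + 1)) ^ 2 := by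
  induction e with
  | const c =>
    have := len_le_natAbs c
    simp only [cost, weight]
    nlinarith [Nat.zero_le (c.natAbs * w), Nat.zero_le ((1 + c.natAbs) * w)]
  | read a ih =>
    have h1 := a.len_eval_le h
    have h2 := h (a.eval μ).toNat
    have h3 := a.one_le_weight
    simp only [cost, weight]
    set A := a.weight * (w + 1) with hA
    have h4 : w + 1 ≤ A := by nlinarith
    have h5 : (1 + a.weight) * (w + 1) = A + (w + 1) := by rw [hA]; ring
    rw [h5]
    nlinarith
  | op o x y hx hy =>
    have h1 := x.len_eval_le h
    have h2 := y.len_eval_le h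
    have h3 := x.one_le_weight
    have h4 := y.one_le_weight
    simp only [cost, weight]
    set A := x.weight * (w + 1) with hA
    set B := y.weight * (w + 1) with hB
    have h5 : 1 ≤ A := by nlinarith
    have h6 : 1 ≤ B := by nlinarith
    have h7 : (1 + x.weight + y.weight) * (w + 1) = A + B + (w + 1) := by rw [hA, hB]; ring
    have h8 : (1 + len (x.eval μ)) * (1 + len (y.eval μ)) ≤ (2 * A) * (2 * B) :=
      Nat.mul_le_mul (by omega) (by omega)
    rw [h7]
    nlinarith [Nat.zero_le ((A + B) * (w + 1))]

/-- The memory contents are zero from the address `top` on and have length at most `w`. -/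
structure Bounded (top w : ℕ) (μ : Mem) : Prop where
  eq_zero : ∀ a, top ≤ a → μ a = 0
  len_le : ∀ a, len (μ a) ≤ w

theorem Bounded.memSize_le {top w : ℕ} {μ : Mem} (h : Bounded top w μ) :
    memSize μ ≤ top * (1 + top + w) := by
  have h1 : μ.support ⊆ Finset.range top := by
    intro a ha
    rw [Finset.mem_range]
    by_contra! hc
    exact Finsupp.mem_support_iff.1 ha (h.eq_zero a hc)
  refine (Finset.sum_le_sum_of_subset h1).trans ?_
  refine (Finset.sum_le_card_nsmul _ _ (1 + top + w) fun a ha => ?_).trans_eq (by simp)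
  have := h.len_le a
  have h2 := len_le_natAbs (a : ℤ)
  have h3 := Finset.mem_range.1 ha
  simp only [Int.natAbs_natCast] at h2
  omega

theorem Bounded.update {top w : ℕ} {μ : Mem} (h : Bounded top w μ) {a : ℕ} (ha : a < top) {x : ℤ}
    (hx : len x ≤ w) : Bounded top w (μ.update a x) := by
  classical
  constructor
  · intro a' ha'
    rw [Finsupp.coe_update, Function.update_of_ne (by omega)]
    exact h.eq_zero a' ha'
  · intro a'
    rw [Finsupp.coe_update, Function.update_apply]
    split_ifs
    · exact hx
    · exact h.len_le a'

/-- The weights of all expressions in a program are bounded by this number. -/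
abbrev maxWeight : ℕ := 1000

/-- A bound on the time of an elementary step. -/
def stepTime (w : ℕ) : ℕ := 8 * (maxWeight * (w + 1)) ^ 2

/-- A bound on the space. -/
def totalSpace (top w : ℕ) : ℕ := top * (1 + top + w) + stepTime w

section

variable {top w : ℕ} {μ : Mem} (h : Bounded top w μ)
include h

/-- The factor `4` here and the factor `8` in `Bounded.len_eval_le` allow a single step to pay for
two evaluations and for storing the result. -/
theorem Bounded.cost_le {e : Expr} (he : e.weight ≤ maxWeight) :
    4 * e.cost μ ≤ stepTime w := by
  have h1 := e.cost_le h.len_le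
  have h2 : (e.weight * (w + 1)) ^ 2 ≤ (maxWeight * (w + 1)) ^ 2 :=
    Nat.pow_le_pow_left (Nat.mul_le_mul_right _ he) 2
  unfold stepTime
  omega

theorem Bounded.len_eval_le {e : Expr} (he : e.weight ≤ maxWeight) :
    8 * (len (e.eval μ) + 1) ≤ stepTime w := by
  have h1 := e.len_eval_le h.len_le
  have h2 : (e.weight * (w + 1)) ≤ (maxWeight * (w + 1)) := Nat.mul_le_mul_right _ he
  unfold stepTime
  nlinarith

theorem Bounded.assign {a e : Expr} (ha : a.weight ≤ maxWeight) (he : e.weight ≤ maxWeight)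
    {ω : List Bool} (hat : (a.eval μ).toNat < top) (hew : len (e.eval μ) ≤ w) :
    ∃ t s, Exec (.assign a e) μ ω (μ.update (a.eval μ).toNat (e.eval μ)) ω t s ∧
      t ≤ stepTime w ∧ s ≤ totalSpace top w := by
  refine ⟨_, _, .assign a e μ ω, ?_, ?_⟩
  · have := h.cost_le ha
    have := h.cost_le he
    have := h.len_eval_le ha
    have := h.len_eval_le he
    omega
  · have := h.cost_le ha
    have := h.cost_le he
    have := h.memSize_le
    have := (h.update hat hew).memSize_le
    unfold totalSpace
    omega

theorem Bounded.flip {a : Expr} (ha : a.weight ≤ maxWeight) {b : Bool} {ω : List Bool}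
    (hat : (a.eval μ).toNat < top) (hw : 1 ≤ w) :
    ∃ t s, Exec (.flip a) μ (b :: ω) (μ.update (a.eval μ).toNat (if b then 1 else 0)) ω t s ∧
      t ≤ stepTime w ∧ s ≤ totalSpace top w := by
  refine ⟨_, _, .flip a μ b ω, ?_, ?_⟩
  · have := h.cost_le ha
    have := h.len_eval_le ha
    omega
  · have := h.cost_le ha
    have := h.memSize_le
    have hb : len (if b then 1 else 0) ≤ w :=
      (len_le_natAbs _).trans (by split_ifs <;> simp [hw])
    have := (h.update hat hb).memSize_le
    unfold totalSpace
    omega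

theorem Bounded.guard {g : Expr} (hg : g.weight ≤ maxWeight) :
    g.cost μ ≤ stepTime w ∧ memSize μ + g.cost μ ≤ totalSpace top w := by
  have := h.cost_le hg
  have := h.memSize_le
  unfold totalSpace
  omega

end

end RAM

/-! ### Programs with named arrays behind the input -/

namespace RAM

/-- The names of the variables and arrays; a variable is an array of which only the entry `0`
is used. -/
inductive Var : Type
  | edge | bit | weight | power | coin | mask | masks | rest | sign | part | prod | pos | idx | acc
  | round | trace | coeff | total | weights | signs | mat | cur | next
  deriving DecidableEq

/-- The number of arrays. -/
abbrev numVars : ℕ := 23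

theorem Var.ctorIdx_lt (v : Var) : v.ctorIdx < numVars := by cases v <;> decide

theorem Var.ctorIdx_injective : Function.Injective Var.ctorIdx := fun v v' h => by
  rw [← Var.ofNat_ctorIdx v, h, Var.ofNat_ctorIdx]

/-- The contents of the arrays. -/
abbrev State : Type := Var → ℕ → ℤ

/-- Change an entry of an array. -/
def State.upd (σ : State) (v : Var) (n : ℕ) (x : ℤ) : State :=
  Function.update σ v (Function.update (σ v) n x)

@[simp] theorem State.upd_of_ne (σ : State) {v v' : Var} (h : v' ≠ v) (n : ℕ) (x : ℤ) :
    σ.upd v n x v' = σ v' := Function.update_of_ne h _ _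

@[simp] theorem State.upd_self (σ : State) (v : Var) (n : ℕ) (x : ℤ) :
    σ.upd v n x v = Function.update (σ v) n x := Function.update_self _ _ _

/-- The fixed data of a run: the instance with `κ + 2` parts of size `q` and `m` edges as written in the memory, and bounds on the lengths of
the arrays and on the lengths of the numbers. -/
structure Env where
  (κ q m size width : ℕ)
  input : ℕ → ℤ
  input_zero : input 0 = (κ + 2 : ℕ)
  input_one : input 1 = q
  input_two : input 2 = m
  vertex : ℕ → ℕ → ℕ
  vertex_lt : ∀ e < m, ∀ j < κ + 2, vertex e j < q
  input_edge : ∀ e < m, ∀ j < κ + 2, input (3 + e * (κ + 2) + j) = vertex e j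
  size_pos : 0 < size
  width_pos : 0 < width

namespace Env

variable (env : Env)

/-- The length of the input. -/
def base : ℕ := 3 + (env.κ + 2) * env.m

/-- All cells from here on are zero. -/
def top : ℕ := env.base + numVars * env.size

/-- The address of an array entry. -/
def address (v : Var) (n : ℕ) : ℕ := v.ctorIdx + env.base + numVars * n

/-- The arrays are interleaved with stride `numVars`: the residue gives the array and the quotient
the index. -/
theorem address_inj {v v' : Var} {n n' : ℕ} :
    env.address v n = env.address v' n' ↔ v = v' ∧ n = n' := by
  refine ⟨fun h => ?_, by rintro ⟨rfl, rfl⟩; rfl⟩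
  have h1 := v.ctorIdx_lt
  have h2 := v'.ctorIdx_lt
  simp only [address, numVars] at *
  exact ⟨Var.ctorIdx_injective (by omega), by omega⟩

theorem address_lt {v : Var} {n : ℕ} (h : n < env.size) : env.address v n < env.top := by
  have h1 := v.ctorIdx_lt
  simp only [address, top, numVars] at *
  omega

/-- The memory `μ` holds the input and the arrays with the contents `σ`. -/
structure Rep (μ : Mem) (σ : State) : Prop where
  input : ∀ a < env.base, μ a = env.input a
  arrays : ∀ v n, μ (env.address v n) = σ v n
  bounded : Bounded env.top env.width μ

/-- In the state `σ` the expression `e` has the value `x`. -/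
def Ev (e : Expr) (σ : State) (x : ℤ) : Prop := ∀ μ, env.Rep μ σ → e.eval μ = x

end Env

/-- The address of an array entry. -/
def addr (v : Var) (i : Expr) : Expr :=
  .op .add (.op .add (.const v.ctorIdx) (.op .add (.const 3)
    (.op .mul (.read (.const 0)) (.read (.const 2))))) (.op .mul (.const numVars) i)

/-- An array entry. -/
def arr (v : Var) (i : Expr) : Expr := .read (addr v i)

/-- The value of a variable. -/
def var (v : Var) : Expr := arr v (.const 0)

/-- The number of parts. -/
def parts : Expr := .read (.const 0)

/-- The size of the parts. -/
def partSize : Expr := .read (.const 1)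

/-- The number of edges. -/
def numEdges : Expr := .read (.const 2)

/-- The number of the vertex of the edge `e` in the part `j`. -/
def vertexAt (e j : Expr) : Expr := .read (.op .add (.op .add (.const 3) (.op .mul e parts)) j)

/-- Assignment to an array entry. -/
def setAt (v : Var) (i e : Expr) : Prog := .assign (addr v i) e

/-- Assignment to a variable. -/
def set (v : Var) (e : Expr) : Prog := setAt v (.const 0) e

/-- A coin toss. -/
def toss (v : Var) : Prog := .flip (addr v (.const 0))

/-- The body of a loop in which `x` counts upwards. -/
def forBody (x : Var) (p : Prog) : Prog := .seq p (set x (.op .add (var x) (.const 1)))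

/-- Execute `p` for `x = 0, …, e - 1`. -/
def forLoop (x : Var) (e : Expr) (p : Prog) : Prog :=
  .seq (set x (.const 0)) (.loop (.op .lt (var x) e) (forBody x p))

theorem natCast_lt_two_pow {a b : ℕ} (h : a ≤ b) : (a : ℤ) < 2 ^ b := by
  exact_mod_cast h.trans_lt Nat.lt_two_pow_self

namespace Env

variable {env : Env} {σ : State}

theorem Ev.cast {e : Expr} {x y : ℤ} (h : env.Ev e σ x) (hxy : x = y) : env.Ev e σ y := hxy ▸ h

theorem Ev.const (c : ℤ) : env.Ev (.const c) σ c := fun _ _ => rfl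

theorem Ev.op (o : Op) {e f : Expr} {x y : ℤ} (he : env.Ev e σ x) (hf : env.Ev f σ y) :
    env.Ev (.op o e f) σ (o.apply x y) := fun μ hμ => by
  rw [Expr.eval, he μ hμ, hf μ hμ]

theorem Ev.add {e f : Expr} {x y : ℤ} (he : env.Ev e σ x) (hf : env.Ev f σ y) :
    env.Ev (.op .add e f) σ (x + y) := .op .add he hf

theorem Ev.sub {e f : Expr} {x y : ℤ} (he : env.Ev e σ x) (hf : env.Ev f σ y) :
    env.Ev (.op .sub e f) σ (x - y) := .op .sub he hf

theorem Ev.mul {e f : Expr} {x y : ℤ} (he : env.Ev e σ x) (hf : env.Ev f σ y) :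
    env.Ev (.op .mul e f) σ (x * y) := .op .mul he hf

theorem Ev.div {e f : Expr} {x y : ℤ} (he : env.Ev e σ x) (hf : env.Ev f σ y) :
    env.Ev (.op .div e f) σ (x / y) := .op .div he hf

theorem Ev.mod {e f : Expr} {x y : ℤ} (he : env.Ev e σ x) (hf : env.Ev f σ y) :
    env.Ev (.op .mod e f) σ (x % y) := .op .mod he hf

theorem Ev.lt {e f : Expr} {x y : ℤ} (he : env.Ev e σ x) (hf : env.Ev f σ y) :
    env.Ev (.op .lt e f) σ (if x < y then 1 else 0) := .op .lt he hf

theorem Ev.input {i : Expr} {n : ℕ} (hi : env.Ev i σ n) (hn : n < env.base) :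
    env.Ev (.read i) σ (env.input n) := fun μ hμ => by
  rw [Expr.eval, hi μ hμ, Int.toNat_natCast, hμ.input n hn]

theorem Ev.parts : env.Ev parts σ (env.κ + 2 : ℕ) :=
  (Ev.input (n := 0) (.const 0) (by simp only [base]; omega)).cast env.input_zero

theorem Ev.partSize : env.Ev partSize σ env.q :=
  (Ev.input (n := 1) (.const 1) (by simp only [base]; omega)).cast env.input_one

theorem Ev.numEdges : env.Ev numEdges σ env.m :=
  (Ev.input (n := 2) (.const 2) (by simp only [base]; omega)).cast env.input_two

theorem Ev.vertex {e j : Expr} {a b : ℕ} (he : env.Ev e σ a) (hj : env.Ev j σ b) (ha : a < env.m)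
    (hb : b < env.κ + 2) : env.Ev (vertexAt e j) σ (env.vertex a b) := by
  refine (Ev.input (n := 3 + a * (env.κ + 2) + b) ((Ev.add (.add (.const 3) (.mul he Ev.parts))
    hj).cast (by push_cast; ring)) ?_).cast (env.input_edge a ha b hb)
  have : (a + 1) * (env.κ + 2) ≤ env.m * (env.κ + 2) := Nat.mul_le_mul_right _ ha
  simp only [base]
  nlinarith

theorem Ev.addr (v : Var) {i : Expr} {n : ℕ} (hi : env.Ev i σ n) :
    env.Ev (addr v i) σ (env.address v n) :=
  (Ev.add (.add (.const _) (.add (.const 3) (.mul Ev.parts Ev.numEdges)))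
    (.mul (.const _) hi)).cast (by simp only [address, base]; push_cast; ring)

theorem Ev.arr (v : Var) {i : Expr} {n : ℕ} (hi : env.Ev i σ n) :
    env.Ev (arr v i) σ (σ v n) := fun μ hμ => by
  rw [RAM.arr, Expr.eval, Ev.addr v hi μ hμ, Int.toNat_natCast, hμ.arrays]

theorem Ev.var (v : Var) : env.Ev (var v) σ (σ v 0) := Ev.arr v (n := 0) (.const 0)

theorem Rep.upd {μ : Mem} (h : env.Rep μ σ) (v : Var) {n : ℕ} (hn : n < env.size) {x : ℤ}
    (hx : len x ≤ env.width) : env.Rep (μ.update (env.address v n) x) (σ.upd v n x) := by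
  classical
  constructor
  · intro a ha
    rw [Finsupp.coe_update, Function.update_of_ne (by simp only [address]; omega), h.input a ha]
  · intro v' n'
    rw [Finsupp.coe_update, Function.update_apply]
    simp only [address_inj]
    by_cases hv : v' = v
    · subst hv
      simp [Function.update_apply, h.arrays]
    · simp [hv, h.arrays]
  · exact h.bounded.update (address_lt env hn) hx

/-- Whatever is already stored is known to fit, so copied values need no separate bound. -/
theorem Rep.abs_lt {μ : Mem} (h : env.Rep μ σ) (v : Var) (n : ℕ) : |σ v n| < 2 ^ env.width := by
  rw [← h.arrays, ← len_le_iff]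
  exact h.bounded.len_le _

/-! ### Program logic with step counting -/

/-- Started in the state `σ` and with the coin tosses `ω` to come, the program `p` halts after at
most `n` elementary steps in a state and with remaining coin tosses which satisfy `Q`. -/
def Wp (env : Env) (p : Prog) (n : ℕ) (Q : State → List Bool → Prop) (σ : State) (ω : List Bool) :
    Prop :=
  ∀ μ, env.Rep μ σ → ∃ μ' ω' t s σ', Exec p μ ω μ' ω' t s ∧ t ≤ n * stepTime env.width ∧
    s ≤ totalSpace env.top env.width ∧ env.Rep μ' σ' ∧ Q σ' ω'

variable {p p' : Prog} {n n' : ℕ} {Q Q' : State → List Bool → Prop} {ω : List Bool}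

theorem Wp.mono (h : env.Wp p n Q σ ω) (hn : n ≤ n') (hQ : ∀ σ ω, Q σ ω → Q' σ ω) :
    env.Wp p n' Q' σ ω := fun μ hμ => by
  obtain ⟨μ', ω', t, s, σ', he, ht, hs, hr, hq⟩ := h μ hμ
  exact ⟨μ', ω', t, s, σ', he, ht.trans (Nat.mul_le_mul_right _ hn), hs, hr, hQ _ _ hq⟩

theorem Wp.seq (h : env.Wp p n (env.Wp p' n' Q) σ ω) : env.Wp (.seq p p') (n + n') Q σ ω := by
  intro μ hμ
  obtain ⟨μ₁, ω₁, t₁, s₁, σ₁, he₁, ht₁, hs₁, hr₁, h₁⟩ := h μ hμ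
  obtain ⟨μ₂, ω₂, t₂, s₂, σ₂, he₂, ht₂, hs₂, hr₂, h₂⟩ := h₁ μ₁ hr₁
  exact ⟨μ₂, ω₂, _, _, σ₂, .seq he₁ he₂, by rw [add_mul]; omega, max_le hs₁ hs₂, hr₂, h₂⟩

theorem wp_setAt {v : Var} {i e : Expr} {a : ℕ} {x : ℤ} (hi : env.Ev i σ a) (he : env.Ev e σ x)
    (ha : a < env.size) (hx : |x| < 2 ^ env.width) (hwi : (addr v i).weight ≤ maxWeight)
    (hwe : e.weight ≤ maxWeight) (hQ : Q (σ.upd v a x) ω) : env.Wp (setAt v i e) 1 Q σ ω := by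
  intro μ hμ
  have h1 := Ev.addr v hi μ hμ
  have h2 := he μ hμ
  have hx' := len_le_iff.2 hx
  obtain ⟨t, s, hex, ht, hs⟩ := hμ.bounded.assign (ω := ω) hwi hwe
    (by rw [h1, Int.toNat_natCast]; exact address_lt env ha) (by rwa [h2])
  rw [h1, h2, Int.toNat_natCast] at hex
  exact ⟨_, _, t, s, _, hex, by omega, hs, hμ.upd v ha hx', hQ⟩

theorem wp_set {v : Var} {e : Expr} {x : ℤ} (he : env.Ev e σ x)
    (hx : |x| < 2 ^ env.width) (hwe : e.weight ≤ maxWeight)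
    (hQ : Q (σ.upd v 0 x) ω) : env.Wp (set v e) 1 Q σ ω :=
  wp_setAt (.const 0) he env.size_pos hx (by cases v <;> decide) hwe hQ

theorem wp_toss {v : Var} {b : Bool} (hQ : Q (σ.upd v 0 (if b then 1 else 0)) ω) :
    env.Wp (toss v) 1 Q σ (b :: ω) := by
  intro μ hμ
  have h1 := Ev.addr v (n := 0) (.const 0) μ hμ
  have hw : (RAM.addr v (.const 0)).weight ≤ maxWeight := by cases v <;> decide
  obtain ⟨t, s, hex, ht, hs⟩ := hμ.bounded.flip (b := b) (ω := ω) hw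
    (by rw [h1, Int.toNat_natCast]; exact address_lt env env.size_pos) env.width_pos
  rw [h1, Int.toNat_natCast] at hex
  exact ⟨_, _, t, s, _, hex, by omega, hs, hμ.upd v env.size_pos
    ((len_le_natAbs _).trans (by have := env.width_pos; split_ifs <;> (simp; try omega))), hQ⟩

/-- Each iteration pays for the body, the guard and the increment; the final `2` pays for the
initialization and the last guard. The invariant at `i + 1` is required after the increment, so that
it may speak about all variables, the counter included. -/
theorem wp_forLoop {x : Var} {e : Expr} {N : ℕ} (I : ℕ → State → List Bool → Prop)
    (hw : (Expr.op .lt (RAM.var x) e).weight ≤ maxWeight)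
    (he : ∀ i ≤ N, ∀ σ ω, I i σ ω → env.Ev e σ N) (hN : (N : ℤ) < 2 ^ env.width)
    (h0 : I 0 (σ.upd x 0 0) ω)
    (hstep : ∀ i < N, ∀ σ ω, I i σ ω → σ x 0 = i →
      env.Wp p n (fun σ' ω' => σ' x 0 = i ∧ I (i + 1) (σ'.upd x 0 (i + 1)) ω') σ ω)
    (hQ : ∀ σ ω, I N σ ω → Q σ ω) : env.Wp (forLoop x e p) (N * (n + 2) + 2) Q σ ω := by
  -- Induction on the number `d` of iterations still to come.
  have key : ∀ d i, i + d = N → ∀ σ ω, I i σ ω → σ x 0 = i →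
      env.Wp (.loop (.op .lt (RAM.var x) e) (forBody x p)) (d * (n + 2) + 1) Q σ ω := by
    intro d
    induction d with
    | zero =>
      intro i hi σ ω hI hx μ hμ
      have hg : (Expr.op .lt (RAM.var x) e).eval μ = 0 := by
        rw [Ev.lt (Ev.var x) (he i (by omega) σ ω hI) μ hμ, hx, if_neg (by omega)]
      have h1 := hμ.bounded.guard hw
      exact ⟨μ, ω, _, _, σ, .loop_done hg, by simpa using h1.1, h1.2, hμ, hQ σ ω (by rwa [← hi])⟩
    | succ d ih =>
      intro i hi σ ω hI hx μ hμ
      have hg : (Expr.op .lt (RAM.var x) e).eval μ ≠ 0 := by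
        rw [Ev.lt (Ev.var x) (he i (by omega) σ ω hI) μ hμ, hx, if_pos (by omega)]
        exact one_ne_zero
      have h1 := hμ.bounded.guard hw
      have h2 : env.Wp (forBody x p) (n + 1)
          (fun σ' ω' => σ' x 0 = (i + 1 : ℕ) ∧ I (i + 1) σ' ω') σ ω := by
        refine Wp.seq ((hstep i (by omega) σ ω hI hx).mono le_rfl fun σ' ω' h => ?_)
        refine wp_set ((Ev.add (Ev.var x) (.const 1)).cast (by rw [h.1])) ?_
          (by cases x <;> decide) ⟨by simp, h.2⟩
        rw [abs_of_nonneg (by omega)]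
        exact lt_of_le_of_lt (by exact_mod_cast (by omega : i + 1 ≤ N)) hN
      obtain ⟨μ₁, ω₁, t₁, s₁, σ₁, he₁, ht₁, hs₁, hr₁, h₁, h₁'⟩ := h2 μ hμ
      obtain ⟨μ₂, ω₂, t₂, s₂, σ₂, he₂, ht₂, hs₂, hr₂, h₂⟩ :=
        ih (i + 1) (by omega) σ₁ ω₁ h₁' h₁ μ₁ hr₁
      refine ⟨μ₂, ω₂, _, _, σ₂, .loop_step hg he₁ he₂, ?_, max_le h1.2 (max_le hs₁ hs₂), hr₂, h₂⟩
      nlinarith [h1.1]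
  have := Wp.seq (wp_set (v := x) (Q := env.Wp _ _ Q) (Ev.const (σ := σ) 0) (by simp) (by decide)
    (key N 0 (by omega) _ ω h0 (by simp)))
  exact this.mono (by omega) fun _ _ h => h

end Env

/-- The states agree except for the given variables. -/
def State.Frame (L : List Var) (σ σ' : State) : Prop := ∀ v, v ∉ L → σ' v = σ v

namespace State

variable {L L' : List Var} {σ σ' σ'' : State}

theorem Frame.refl : Frame L σ σ := fun _ _ => rfl

theorem Frame.upd (h : Frame L σ σ') {v : Var} (hv : v ∈ L) {n : ℕ} {x : ℤ} :
    Frame L σ (σ'.upd v n x) := fun v' hv' => by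
  rw [upd_of_ne _ (fun hc : v' = v => hv' (hc ▸ hv)), h v' hv']

theorem Frame.trans (h : Frame L σ σ') (h' : Frame L' σ' σ'') (hL : L' ⊆ L) : Frame L σ σ'' :=
  fun v hv => by rw [h' v fun hc => hv (hL hc), h v hv]

end State

end RAM

/-! ### Drawing the weights -/

namespace RAM

open State Env

/-- The number of unconstrained parts. -/
def restParts : Expr := .op .sub parts (.const 2)

/-- The number of bits of a weight. -/
def weightBits : Expr := .op .add (.op .mul parts partSize) partSize

/-- Toss a coin and append it to the weight. -/
def drawBit : Prog :=
  .seq (toss .coin) (.seq (set .weight (.op .add (var .weight) (.op .mul (var .coin) (var .power))))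
    (set .power (.op .mul (var .power) (.const 2))))

/-- Draw the weight of one edge. -/
def drawWeight : Prog :=
  .seq (set .weight (.const 0)) (.seq (set .power (.const 1)) (.seq (forLoop .bit weightBits drawBit)
    (setAt .weights (var .edge) (var .weight))))

/-- Draw the weights of all edges. -/
def drawWeights : Prog := forLoop .edge numEdges drawWeight

namespace Env

variable {env : Env} {σ : State}

theorem Ev.restParts : env.Ev restParts σ env.κ :=
  (Ev.sub Ev.parts (.const 2)).cast (by push_cast; ring)

variable (env) in
/-- The number of bits of a weight. -/
def numBits : ℕ := (env.κ + 2) * env.q + env.q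

theorem Ev.weightBits : env.Ev weightBits σ env.numBits :=
  (Ev.add (.mul Ev.parts Ev.partSize) Ev.partSize).cast (by simp [Env.numBits])

/-- The number with the given binary digits. -/
def drawn (g : ℕ → Bool) (t n : ℕ) : ℤ := ∑ b ∈ Finset.range n, (if g (t + b) then 1 else 0) * 2 ^ b

theorem drawn_nonneg (g : ℕ → Bool) (t n : ℕ) : 0 ≤ drawn g t n :=
  Finset.sum_nonneg fun b _ => by split_ifs <;> simp

theorem drawn_lt (g : ℕ → Bool) (t n : ℕ) : drawn g t n < 2 ^ n := by
  induction n with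
  | zero => simp [drawn]
  | succ n ih =>
    rw [drawn, Finset.sum_range_succ, ← drawn, pow_succ]
    have : (0 : ℤ) < 2 ^ n := by positivity
    split_ifs <;> omega

/-- The coin tosses `t, …, t + r - 1`. -/
def tosses (g : ℕ → Bool) (t r : ℕ) : List Bool := (List.range' t r).map g

theorem tosses_succ (g : ℕ → Bool) (t r : ℕ) : tosses g t (r + 1) = g t :: tosses g (t + 1) r := rfl

/-- After `i` tosses the weight is the number formed by the first `i` binary digits, lowest first,
and `power` is the value of the next digit. -/
theorem wp_drawWeight (g : ℕ → Bool) (t r e : ℕ) (he : σ .edge 0 = e) (hes : e < env.size)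
    (hw : env.numBits < env.width) :
    env.Wp drawWeight (env.numBits * 5 + 5) (fun σ' ω' =>
      Frame [.coin, .weight, .power, .bit, .weights] σ σ' ∧
      σ' .weights = Function.update (σ .weights) e (drawn g t env.numBits) ∧
      ω' = tosses g (t + env.numBits) r) σ (tosses g t (env.numBits + r)) := by
  have hpow : (2 : ℤ) ^ env.numBits < 2 ^ env.width := pow_lt_pow_right₀ one_lt_two hw
  refine Wp.mono (Wp.seq (wp_set (.const 0) (by simp) (by decide) (Wp.seq (wp_set (.const 1)
    (by rw [abs_one]; exact one_lt_pow₀ one_lt_two (by omega)) (by decide)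
      (Wp.seq (wp_forLoop (n := 1 + (1 + 1)) (fun i σ' ω' => Frame [.coin, .weight, .power, .bit] σ σ' ∧
        σ' .weight 0 = drawn g t i ∧ σ' .power 0 = 2 ^ i ∧
        ω' = tosses g (t + i) (env.numBits - i + r)) (by decide) (fun _ _ _ _ _ => Ev.weightBits)
        ?_ ?_ ?_ ?_)))))) (n := 1 + (1 + (env.numBits * (1 + (1 + 1) + 2) + 2 + 1))) (by omega) fun _ _ h => h
  · exact natCast_lt_two_pow hw.le
  · refine ⟨((Frame.refl.upd ?_).upd ?_).upd ?_, ?_, ?_, ?_⟩ <;> simp [drawn]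
  · rintro i hi σ' ω' ⟨hF, h1, h2, rfl⟩ h3
    rw [show env.numBits - i + r = env.numBits - (i + 1) + r + 1 by omega, tosses_succ]
    have h4 : (2 : ℤ) ^ (i + 1) ≤ 2 ^ env.numBits := pow_le_pow_right₀ one_le_two hi
    have h5 := drawn_lt g t (i + 1)
    have h6 := drawn_nonneg g t (i + 1)
    refine Wp.seq (wp_toss (Wp.seq (wp_set ((Ev.add (Ev.var _) (.mul (Ev.var _) (Ev.var _))).cast
      (y := drawn g t (i + 1)) ?_) ?_ (by decide +kernel) (wp_set ((Ev.mul (Ev.var _) (.const 2)).cast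
      (y := 2 ^ (i + 1)) ?_) ?_ (by decide +kernel) ?_))))
    · rw [drawn, Finset.sum_range_succ, ← drawn]
      simp [h1, h2]
    · rw [abs_of_nonneg h6]; omega
    · simp [h2, pow_succ]
    · rw [abs_of_nonneg (by positivity)]; omega
    · refine ⟨by simp [h3], (((hF.upd ?_).upd ?_).upd ?_).upd ?_, ?_, ?_, rfl⟩ <;> simp
  · rintro σ' ω' ⟨hF, h1, h2, rfl⟩
    refine wp_setAt (a := e) ((Ev.var _).cast ?_) (Ev.var _) hes ?_ (by decide) (by decide) ⟨?_, ?_, ?_⟩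
    · rw [hF _ (by decide), he]
    · rw [h1, abs_of_nonneg (drawn_nonneg _ _ _)]
      exact (drawn_lt _ _ _).trans hpow
    · exact (Frame.refl.trans hF (by decide)).upd (by decide)
    · simp [h1, hF .weights (by decide)]
    · simp

theorem wp_drawWeights (g : ℕ → Bool) (hm : env.m ≤ env.size)
    (hw : env.numBits < env.width) (hmw : env.m ≤ env.width) :
    env.Wp drawWeights (env.m * (env.numBits * 5 + 7) + 2) (fun σ' _ =>
      Frame [.coin, .weight, .power, .bit, .weights, .edge] σ σ' ∧
      ∀ e < env.m, σ' .weights e = drawn g (e * env.numBits) env.numBits) σ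
        (tosses g 0 (env.m * env.numBits)) := by
  refine wp_forLoop (n := env.numBits * 5 + 5) (fun i σ' ω' =>
    Frame [.coin, .weight, .power, .bit, .weights, .edge] σ σ' ∧
    (∀ e < i, σ' .weights e = drawn g (e * env.numBits) env.numBits) ∧
    ω' = tosses g (i * env.numBits) ((env.m - i) * env.numBits)) (by decide)
    (fun _ _ _ _ _ => Ev.numEdges) ?_ ?_ ?_ ?_
  · exact natCast_lt_two_pow hmw
  · exact ⟨Frame.refl.upd (by decide), by simp, by simp⟩
  · rintro i hi σ' ω' ⟨hF, h1, rfl⟩ h2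
    rw [show (env.m - i) * env.numBits = env.numBits + (env.m - (i + 1)) * env.numBits by
      rw [show env.m - i = env.m - (i + 1) + 1 by omega]; ring]
    refine (wp_drawWeight g _ _ i h2 (by omega) hw).mono le_rfl ?_
    rintro σ'' ω'' ⟨hF', h3, rfl⟩
    refine ⟨by rw [hF' _ (by decide), h2], (hF.trans hF' (by decide)).upd (by decide), ?_, ?_⟩
    · intro e he
      rw [upd_of_ne _ (by decide), h3, Function.update_apply]
      split_ifs with hei
      · rw [hei]
      · exact h1 e (by omega)
    · rw [add_mul, one_mul]
  · exact fun σ' ω' h => ⟨h.1, h.2.1⟩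

end Env

end RAM

/-! ### Building the matrix -/

namespace RAM

open State Env

/-- The number of vertices in the unconstrained parts. -/
def maskBits : Expr := .op .mul restParts partSize

/-- Compute the number of masks. -/
def countMasks : Prog :=
  .seq (set .masks (.const 1))
    (forLoop .bit maskBits (set .masks (.op .mul (var .masks) (.const 2))))

/-- Compute one sign. -/
def signBit : Prog :=
  .seq (setAt .signs (var .bit)
    (.op .sub (.const 1) (.op .mul (.const 2) (.op .mod (var .rest) (.const 2)))))
    (.seq (set .sign (.op .mul (var .sign) (arr .signs (var .bit))))
      (set .rest (.op .div (var .rest) (.const 2))))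

/-- Compute the signs that belong to the mask, and their product. -/
def computeSigns : Prog :=
  .seq (set .rest (var .mask)) (.seq (set .sign (.const 1)) (forLoop .bit maskBits signBit))

/-- Clear the matrix. -/
def clearMat : Prog :=
  forLoop .pos (.op .mul partSize partSize) (setAt .mat (var .pos) (.const 0))

/-- Multiply the weight of an edge with the signs of its vertices. -/
def edgeProd : Prog :=
  .seq (set .prod (arr .weights (var .edge))) (forLoop .part restParts
    (set .prod (.op .mul (var .prod) (arr .signs (.op .add (.op .mul (var .part) partSize)
      (vertexAt (var .edge) (.op .add (var .part) (.const 2))))))))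

/-- The position in the matrix to which an edge contributes. -/
def edgePos : Expr :=
  .op .add (.op .mul (vertexAt (var .edge) (.const 0)) partSize) (vertexAt (var .edge) (.const 1))

/-- Add the contribution of an edge to the matrix. -/
def addEdge : Prog :=
  .seq edgeProd (setAt .mat edgePos (.op .add (arr .mat edgePos) (var .prod)))

/-- Compute the matrix. -/
def buildMat : Prog := .seq clearMat (forLoop .edge numEdges addEdge)

namespace Env

variable {env : Env} {σ : State} {ω : List Bool}

theorem Ev.maskBits : env.Ev maskBits σ (env.κ * env.q : ℕ) :=
  (Ev.mul Ev.restParts Ev.partSize).cast (by push_cast; ring)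

theorem wp_countMasks (hw : env.κ * env.q < env.width) :
    env.Wp countMasks (env.κ * env.q * 3 + 3) (fun σ' ω' => Frame [.bit, .masks] σ σ' ∧
      σ' .masks 0 = 2 ^ (env.κ * env.q) ∧ ω' = ω) σ ω := by
  have hpow : (2 : ℤ) ^ (env.κ * env.q) < 2 ^ env.width := pow_lt_pow_right₀ one_lt_two hw
  refine Wp.mono (n := 1 + (env.κ * env.q * (1 + 2) + 2)) (Wp.seq (wp_set (.const 1)
    (by rw [abs_one]; exact one_lt_pow₀ one_lt_two (by omega)) (by decide)
      (wp_forLoop (n := 1) (fun i σ' ω' => Frame [.bit, .masks] σ σ' ∧ σ' .masks 0 = 2 ^ i ∧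
        ω' = ω) (by decide) (fun _ _ _ _ _ => Ev.maskBits) (natCast_lt_two_pow hw.le) ?_ ?_ ?_)))
      (by omega) fun _ _ h => h
  · refine ⟨(Frame.refl.upd ?_).upd ?_, ?_, rfl⟩ <;> simp
  · rintro i hi σ' ω' ⟨hF, h1, rfl⟩ h2
    have h3 : (2 : ℤ) ^ (i + 1) ≤ 2 ^ (env.κ * env.q) := pow_le_pow_right₀ one_le_two hi
    refine wp_set (x := 2 ^ (i + 1)) ((Ev.mul (Ev.var _) (.const 2)).cast (by rw [h1, pow_succ])) ?_
      (by decide) ?_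
    · rw [abs_of_nonneg (by positivity)]; omega
    · refine ⟨by simp [h2], (hF.upd ?_).upd ?_, ?_, rfl⟩ <;> simp
  · exact fun _ _ h => h

/-- The sign that the mask `X` prescribes for its bit `i`. -/
def maskSign (X i : ℕ) : ℤ := 1 - 2 * (X / 2 ^ i % 2 : ℕ)

theorem abs_maskSign (X i : ℕ) : |maskSign X i| = 1 := by
  rcases Nat.mod_two_eq_zero_or_one (X / 2 ^ i) with h | h <;> simp [maskSign, h]

theorem abs_prod_maskSign {ι : Type*} (s : Finset ι) (X : ℕ) (f : ι → ℕ) :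
    |∏ i ∈ s, maskSign X (f i)| = 1 := by
  rw [Finset.abs_prod]
  exact Finset.prod_eq_one fun i _ => abs_maskSign _ _

theorem wp_computeSigns {X : ℕ} (hX : σ .mask 0 = X) (hw : env.κ * env.q < env.width)
    (hs : env.κ * env.q ≤ env.size) :
    env.Wp computeSigns (env.κ * env.q * 5 + 4) (fun σ' ω' =>
      Frame [.bit, .rest, .sign, .signs] σ σ' ∧
      (∀ i < env.κ * env.q, σ' .signs i = maskSign X i) ∧
      σ' .sign 0 = ∏ i ∈ Finset.range (env.κ * env.q), maskSign X i ∧ ω' = ω) σ ω := by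
  intro μ hμ
  -- The mask is bounded because it is stored in memory; all its later quotients are smaller.
  have hXw : |(X : ℤ)| < 2 ^ env.width := hX ▸ hμ.abs_lt .mask 0
  have hw1 : (1 : ℤ) < 2 ^ env.width := one_lt_pow₀ one_lt_two (by omega)
  refine Wp.mono (n := 1 + (1 + (env.κ * env.q * (1 + (1 + 1) + 2) + 2))) (Wp.seq (wp_set
    ((Ev.var _).cast hX) hXw (by decide) (Wp.seq (wp_set (.const 1) (by simpa using hw1) (by decide)
      (wp_forLoop (n := 1 + (1 + 1)) (fun i σ' ω' => Frame [.bit, .rest, .sign, .signs] σ σ' ∧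
        (∀ j < i, σ' .signs j = maskSign X j) ∧
        σ' .sign 0 = ∏ j ∈ Finset.range i, maskSign X j ∧ σ' .rest 0 = (X / 2 ^ i : ℕ) ∧ ω' = ω)
        (by decide) (fun _ _ _ _ _ => Ev.maskBits) (natCast_lt_two_pow hw.le) ?_ ?_ ?_)))))
      (by omega) (fun _ _ h => h) μ hμ
  · refine ⟨((Frame.refl.upd ?_).upd ?_).upd ?_, ?_, ?_, ?_, rfl⟩ <;> simp
  · rintro i hi σ' ω' ⟨hF, h1, h2, h3, rfl⟩ h4
    have h5 : 1 - 2 * (((X / 2 ^ i : ℕ) : ℤ) % 2) = maskSign X i := by simp [maskSign]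
    refine Wp.seq (wp_setAt (a := i) (x := maskSign X i) ((Ev.var _).cast h4)
      ((Ev.sub (.const 1) (.mul (.const 2) (.mod (.var _) (.const 2)))).cast (by rw [h3, h5]))
      (by omega) (by rwa [abs_maskSign]) (by decide) (by decide) (Wp.seq (wp_set
      (x := ∏ j ∈ Finset.range (i + 1), maskSign X j)
      ((Ev.mul (.var _) (.arr _ (n := i) ((Ev.var _).cast ?_))).cast ?_) ?_ (by decide) (wp_set
      (x := (X / 2 ^ (i + 1) : ℕ)) ((Ev.div (.var _) (.const 2)).cast ?_) ?_ (by decide) ?_))))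
    · simp [h4]
    · simp [h2, Finset.prod_range_succ]
    · rwa [abs_prod_maskSign _ X fun i => i]
    · rw [pow_succ, ← Nat.div_div_eq_div_mul]; simp [h3]
    · refine lt_of_le_of_lt ?_ hXw
      rw [Nat.abs_cast, Nat.abs_cast]
      exact_mod_cast Nat.div_le_self _ _
    · refine ⟨by simp [h4], (((hF.upd ?_).upd ?_).upd ?_).upd ?_, ?_, ?_, ?_, rfl⟩
      case refine_5 =>
        intro j hj
        rcases eq_or_ne j i with rfl | hji
        · simp
        · simp [hji, h1 j (by omega)]
      all_goals simp
  · exact fun _ _ h => ⟨h.1, h.2.1, h.2.2.1, h.2.2.2.2⟩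

variable (env) in
/-- The weight of an edge, multiplied with the signs of its vertices. -/
def edgeTerm (w : ℕ → ℤ) (X e : ℕ) : ℤ :=
  w e * ∏ l ∈ Finset.range env.κ, maskSign X (l * env.q + env.vertex e (l + 2))

theorem abs_edgeTerm (w : ℕ → ℤ) (X e : ℕ) : |env.edgeTerm w X e| = |w e| := by
  rw [edgeTerm, abs_mul, abs_prod_maskSign, mul_one]

variable (env) in
/-- The contribution of the first `n` edges to an entry of the matrix. -/
def matEntry (w : ℕ → ℤ) (X n r c : ℕ) : ℤ :=
  ∑ e ∈ Finset.range n, if env.vertex e 0 = r ∧ env.vertex e 1 = c then env.edgeTerm w X e else 0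

theorem abs_matEntry_le {w : ℕ → ℤ} {n : ℕ} {b : ℤ} (hw : ∀ e < n, |w e| ≤ b) (X r c : ℕ) :
    |env.matEntry w X n r c| ≤ n * b := by
  refine (Finset.abs_sum_le_sum_abs _ _).trans
    ((Finset.sum_le_card_nsmul _ _ b fun e he => ?_).trans_eq (by simp))
  have h1 := hw e (Finset.mem_range.1 he)
  split_ifs
  · rwa [abs_edgeTerm]
  · rw [abs_zero]; exact (abs_nonneg _).trans h1

theorem wp_edgeProd {w : ℕ → ℤ} {X e : ℕ} (he : σ .edge 0 = e) (hem : e < env.m)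
    (hwe : σ .weights e = w e) (hs : ∀ i < env.κ * env.q, σ .signs i = maskSign X i)
    (hw : env.κ ≤ env.width) :
    env.Wp edgeProd (env.κ * 3 + 3) (fun σ' ω' => Frame [.prod, .part] σ σ' ∧
      σ' .prod 0 = env.edgeTerm w X e ∧ ω' = ω) σ ω := by
  intro μ hμ
  have hb : |w e| < 2 ^ env.width := hwe ▸ hμ.abs_lt .weights e
  refine Wp.mono (n := 1 + (env.κ * (1 + 2) + 2)) (Wp.seq (wp_set
    ((Ev.arr _ ((Ev.var _).cast he)).cast hwe) hb (by decide)
      (wp_forLoop (n := 1) (fun i σ' ω' => Frame [.prod, .part] σ σ' ∧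
        σ' .prod 0 = w e * ∏ l ∈ Finset.range i, maskSign X (l * env.q + env.vertex e (l + 2)) ∧
        ω' = ω) (by decide) (fun _ _ _ _ _ => Ev.restParts) (natCast_lt_two_pow hw) ?_ ?_ ?_)))
      (by omega) (fun _ _ h => h) μ hμ
  · refine ⟨(Frame.refl.upd ?_).upd ?_, ?_, rfl⟩ <;> simp
  · rintro i hi σ' ω' ⟨hF, h1, rfl⟩ h2
    have h3 := env.vertex_lt e hem (i + 2) (by omega)
    have h4 : (i + 1) * env.q ≤ env.κ * env.q := Nat.mul_le_mul_right _ hi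
    rw [add_mul] at h4
    refine wp_set (x := w e * ∏ l ∈ Finset.range (i + 1), maskSign X (l * env.q + env.vertex e (l + 2)))
      ((Ev.mul (.var _) (.arr _ (n := i * env.q + env.vertex e (i + 2))
        ((Ev.add (.mul (.var _) Ev.partSize) (.vertex (a := e) (b := i + 2) ((Ev.var _).cast ?_)
          ((Ev.add (.var _) (.const 2)).cast ?_) hem (by omega))).cast ?_))).cast ?_) ?_
        (by decide +kernel) ?_
    · rw [hF _ (by decide), he]
    · rw [h2]; rfl
    · rw [h2]; push_cast; rfl
    · rw [h1, hF _ (by decide), hs _ (by omega), Finset.prod_range_succ]; ring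
    · rwa [abs_mul, abs_prod_maskSign, mul_one]
    · refine ⟨by simp [h2], (hF.upd ?_).upd ?_, ?_, rfl⟩ <;> simp
  · exact fun _ _ h => h

theorem wp_clearMat (hs : env.q * env.q ≤ env.size) (hw : env.q * env.q ≤ env.width) :
    env.Wp clearMat (env.q * env.q * 3 + 2) (fun σ' ω' => Frame [.mat, .pos] σ σ' ∧
      (∀ i < env.q * env.q, σ' .mat i = 0) ∧ ω' = ω) σ ω := by
  refine wp_forLoop (n := 1) (fun i σ' ω' => Frame [.mat, .pos] σ σ' ∧
      (∀ j < i, σ' .mat j = 0) ∧ ω' = ω) (by decide)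
      (fun _ _ _ _ _ => (Ev.mul Ev.partSize Ev.partSize).cast (by push_cast; rfl))
      (natCast_lt_two_pow hw) ?_ ?_ ?_
  · exact ⟨Frame.refl.upd (by decide), by simp, rfl⟩
  · rintro i hi σ' ω' ⟨hF, h1, rfl⟩ h2
    refine wp_setAt (a := i) ((Ev.var _).cast h2) (.const 0) (by omega) (by simp) (by decide)
      (by decide) ⟨by simp [h2], (hF.upd (by decide)).upd (by decide), ?_, rfl⟩
    intro j hj
    rcases eq_or_ne j i with rfl | hji
    · simp
    · simp [hji, h1 j (by omega)]
  · exact fun _ _ h => h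

theorem eq_mul_add_iff {q u v n : ℕ} (hv : v < q) : n = u * q + v ↔ u = n / q ∧ v = n % q := by
  constructor
  · rintro rfl
    rw [mul_comm, Nat.mul_add_div (by omega), Nat.mul_add_mod, Nat.div_eq_of_lt hv,
      Nat.mod_eq_of_lt hv]
    simp
  · rintro ⟨rfl, rfl⟩
    rw [mul_comm, Nat.div_add_mod]

/-- After `n` edges the array holds the contributions of these edges to all entries. Signs do not
change absolute values, so `m * b` bounds every partial sum. -/
theorem wp_buildMat {w : ℕ → ℤ} {X : ℕ} {b : ℤ} (hwe : ∀ e < env.m, σ .weights e = w e)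
    (hb : ∀ e < env.m, |w e| ≤ b) (hbw : env.m * b < 2 ^ env.width)
    (hs : ∀ i < env.κ * env.q, σ .signs i = maskSign X i)
    (hw : env.κ ≤ env.width) (hmw : env.m ≤ env.width) (hqs : env.q * env.q ≤ env.size)
    (hqw : env.q * env.q ≤ env.width) :
    env.Wp buildMat (env.q * env.q * 3 + 2 + (env.m * (env.κ * 3 + 6) + 2)) (fun σ' ω' =>
      Frame [.mat, .pos, .prod, .part, .edge] σ σ' ∧
      (∀ i < env.q * env.q, σ' .mat i = env.matEntry w X env.m (i / env.q) (i % env.q)) ∧ ω' = ω)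
      σ ω := by
  refine Wp.seq ((wp_clearMat hqs hqw).mono le_rfl ?_)
  rintro σ₁ ω₁ ⟨hF₁, h0, hω⟩
  rw [hω]
  refine wp_forLoop (n := env.κ * 3 + 3 + 1) (fun n σ' ω' =>
    Frame [.mat, .pos, .prod, .part, .edge] σ σ' ∧
    (∀ i < env.q * env.q, σ' .mat i = env.matEntry w X n (i / env.q) (i % env.q)) ∧ ω' = ω)
    (by decide) (fun _ _ _ _ _ => Ev.numEdges) (natCast_lt_two_pow hmw) ?_ ?_ ?_
  · refine ⟨(Frame.refl.trans hF₁ (by decide)).upd (by decide), fun i hi => ?_, rfl⟩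
    rw [upd_of_ne _ (by decide), h0 i hi]
    simp [matEntry]
  · rintro e he σ' ω' ⟨hF, h1, rfl⟩ h2
    refine Wp.seq ((wp_edgeProd (w := w) (X := X) h2 he (by rw [hF _ (by decide), hwe e he])
      (fun i hi => by rw [hF _ (by decide), hs i hi]) hw).mono le_rfl ?_)
    rintro σ'' ω'' ⟨hF', h3, rfl⟩
    have hu := env.vertex_lt e he 0 (by omega)
    have hv := env.vertex_lt e he 1 (by omega)
    set u := env.vertex e 0 with hu'
    set v := env.vertex e 1 with hv'
    have huv : u * env.q + v < env.q * env.q := by nlinarith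
    -- A new edge affects only the position given by its vertices in the first two parts.
    have hsucc : ∀ i, env.matEntry w X (e + 1) (i / env.q) (i % env.q) =
        env.matEntry w X e (i / env.q) (i % env.q) +
          if i = u * env.q + v then env.edgeTerm w X e else 0 := by
      intro i
      rw [matEntry, Finset.sum_range_succ, ← matEntry, ← hu', ← hv']
      simp only [eq_mul_add_iff hv]
    have hpos : env.Ev edgePos σ'' (u * env.q + v : ℕ) := by
      have he' : env.Ev (RAM.var .edge) σ'' e := (Ev.var _).cast (by rw [hF' _ (by decide), h2])
      exact (Ev.add (.mul (.vertex (b := 0) he' (.const 0) he (by omega)) Ev.partSize)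
        (.vertex (b := 1) he' (.const 1) he (by omega))).cast (by push_cast; rfl)
    refine wp_setAt (x := env.matEntry w X (e + 1) ((u * env.q + v) / env.q) ((u * env.q + v) % env.q))
      hpos ((Ev.add (.arr _ hpos) (.var _)).cast ?_) (by omega) ?_ (by decide +kernel)
      (by decide +kernel) ⟨?_, ?_, ?_, rfl⟩
    · rw [hF' _ (by decide), h1 _ huv, h3, hsucc, if_pos rfl]
    · refine lt_of_le_of_lt ((abs_matEntry_le (fun e' he' => hb e' (by omega)) _ _ _).trans ?_) hbw
      have hb0 : 0 ≤ b := (abs_nonneg _).trans (hb e he)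
      exact mul_le_mul_of_nonneg_right (by exact_mod_cast he) hb0
    · rw [upd_of_ne _ (by decide), hF' _ (by decide), h2]
    · exact ((hF.trans hF' (by decide)).upd (by decide)).upd (by decide)
    · intro i hi
      rw [upd_of_ne _ (by decide), upd_self, Function.update_apply]
      split_ifs with hi'
      · rw [hi']
      · rw [hF' _ (by decide), h1 i hi, hsucc, if_neg hi', add_zero]
  · exact fun _ _ h => h

end Env

end RAM

/-! ### The program for the Faddeev–LeVerrier algorithm -/

namespace RAM

open State Env

/-- The row of the current position. -/
def row : Expr := .op .div (var .pos) partSize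

/-- The column of the current position. -/
def col : Expr := .op .mod (var .pos) partSize

/-- Whether the current position is on the diagonal. -/
def onDiag : Expr := .op .sub (.op .sub (.const 1) (.op .lt row col)) (.op .lt col row)

/-- Execute `p` for all positions in a matrix. -/
def forPos (p : Prog) : Prog := forLoop .pos (.op .mul partSize partSize) p

/-- Compute one entry of a matrix product. -/
def dotProduct : Prog :=
  .seq (set .acc (.const 0)) (forLoop .idx partSize (set .acc (.op .add (var .acc)
    (.op .mul (arr .mat (.op .add (.op .mul row partSize) (var .idx)))
      (arr .cur (.op .add (.op .mul (var .idx) partSize) col))))))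

/-- Compute the product of two matrices. -/
def mulMat : Prog := forPos (.seq dotProduct (setAt .next (var .pos) (var .acc)))

/-- Compute the trace of the product. -/
def computeTrace : Prog :=
  .seq (set .trace (.const 0)) (forLoop .idx partSize (set .trace (.op .add (var .trace)
    (arr .next (.op .add (.op .mul (var .idx) partSize) (var .idx))))))

/-- Compute the next coefficient. -/
def nextCoeff : Prog :=
  set .coeff (.op .div (.op .sub (.const 0) (var .trace)) (.op .add (var .round) (.const 1)))

/-- Compute the next matrix. -/
def nextMat : Prog :=
  forPos (setAt .cur (var .pos) (.op .add (arr .next (var .pos)) (.op .mul onDiag (var .coeff))))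

/-- Compute the determinant of the matrix up to the sign. -/
def leverrier : Prog :=
  .seq (forPos (setAt .cur (var .pos) onDiag)) (.seq (set .coeff (.const 1))
    (forLoop .round partSize (.seq mulMat (.seq computeTrace (.seq nextCoeff nextMat)))))

namespace Env

variable {env : Env} {σ : State} {ω : List Bool}

theorem Ev.row {n : ℕ} (h : σ .pos 0 = n) : env.Ev row σ (n / env.q : ℕ) :=
  (Ev.div (.var _) Ev.partSize).cast (by rw [h]; rfl)

theorem Ev.col {n : ℕ} (h : σ .pos 0 = n) : env.Ev col σ (n % env.q : ℕ) :=
  (Ev.mod (.var _) Ev.partSize).cast (by rw [h]; rfl)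

theorem Ev.onDiag {n : ℕ} (h : σ .pos 0 = n) :
    env.Ev onDiag σ (if n / env.q = n % env.q then 1 else 0) :=
  (Ev.sub (.sub (.const 1) (.lt (Ev.row h) (Ev.col h))) (.lt (Ev.col h) (Ev.row h))).cast
    (by split_ifs <;> omega)

/-- The array holds the first `q` rows and columns of the matrix, one row after the other. -/
def Holds (q : ℕ) (f : ℕ → ℤ) (a : ℕ → ℕ → ℤ) : Prop := ∀ i < q * q, f i = a (i / q) (i % q)

theorem index_lt {q r c : ℕ} (hr : r < q) (hc : c < q) : r * q + c < q * q := by nlinarith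

theorem Holds.apply {q : ℕ} {f : ℕ → ℤ} {a : ℕ → ℕ → ℤ} (h : Holds q f a) {r c : ℕ} (hr : r < q)
    (hc : c < q) : f (r * q + c) = a r c := by
  have h1 := (eq_mul_add_iff (u := r) (n := r * q + c) hc).1 rfl
  rw [h _ (index_lt hr hc), ← h1.1, ← h1.2]

theorem div_lt_of_lt_mul {q n : ℕ} (h : n < q * q) : n / q < q := Nat.div_lt_of_lt_mul h

theorem mod_lt_of_lt_mul {q n : ℕ} (h : n < q * q) : n % q < q :=
  Nat.mod_lt _ (by rcases Nat.eq_zero_or_pos q with rfl | h' <;> omega)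

theorem wp_forPos {p : Prog} {n : ℕ} {Q : State → List Bool → Prop}
    (I : ℕ → State → List Bool → Prop) (hqw : env.q * env.q ≤ env.width)
    (h0 : I 0 (σ.upd .pos 0 0) ω)
    (hstep : ∀ i < env.q * env.q, ∀ σ ω, I i σ ω → σ .pos 0 = i →
      env.Wp p n (fun σ' ω' => σ' .pos 0 = i ∧ I (i + 1) (σ'.upd .pos 0 (i + 1)) ω') σ ω)
    (hQ : ∀ σ ω, I (env.q * env.q) σ ω → Q σ ω) :
    env.Wp (forPos p) (env.q * env.q * (n + 2) + 2) Q σ ω :=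
  wp_forLoop I (by decide)
    (fun _ _ _ _ _ => (Ev.mul Ev.partSize Ev.partSize).cast (by push_cast; rfl))
    (natCast_lt_two_pow hqw) h0 hstep hQ

/-- Fill an array with the entries of a matrix. -/
theorem wp_forPos_setAt {v : Var} {e : Expr} {a : ℕ → ℕ → ℤ} (hv : v ≠ .pos)
    (hqw : env.q * env.q ≤ env.width) (hqs : env.q * env.q ≤ env.size)
    (ha : ∀ r < env.q, ∀ c < env.q, |a r c| < 2 ^ env.width) (hwe : e.weight ≤ maxWeight)
    (he : ∀ i < env.q * env.q, ∀ σ', Frame [v, .pos] σ σ' → σ' .pos 0 = i →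
      env.Ev e σ' (a (i / env.q) (i % env.q))) :
    env.Wp (forPos (setAt v (RAM.var .pos) e)) (env.q * env.q * 3 + 2) (fun σ' ω' =>
      Frame [v, .pos] σ σ' ∧ Holds env.q (σ' v) a ∧ ω' = ω) σ ω := by
  refine wp_forPos (n := 1) (fun n σ' ω' => Frame [v, .pos] σ σ' ∧
    (∀ i < n, σ' v i = a (i / env.q) (i % env.q)) ∧ ω' = ω) hqw ?_ ?_ ?_
  · exact ⟨Frame.refl.upd (by simp), by simp, rfl⟩
  · rintro i hi σ' ω' ⟨hF, h1, rfl⟩ h2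
    refine wp_setAt (a := i) ((Ev.var _).cast h2) (he i hi σ' hF h2) (by omega)
      (ha _ (div_lt_of_lt_mul hi) _ (mod_lt_of_lt_mul hi)) (by cases v <;> decide +kernel) hwe
      ⟨by rw [upd_of_ne _ hv.symm, h2], (hF.upd (by simp)).upd (by simp), ?_, rfl⟩
    intro j hj
    rw [upd_of_ne _ hv, upd_self, Function.update_apply]
    split_ifs with hji
    · rw [hji]
    · exact h1 j (by omega)
  · exact fun _ _ h => h

theorem abs_sum_range_le {n q : ℕ} {f : ℕ → ℤ} {b : ℤ} (hb : 0 ≤ b) (hn : n ≤ q)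
    (h : ∀ i < q, |f i| ≤ b) : |∑ i ∈ Finset.range n, f i| ≤ q * b := by
  refine (Finset.abs_sum_le_sum_abs _ _).trans ?_
  refine (Finset.sum_le_card_nsmul _ _ b fun i hi => h i ?_).trans ?_
  · exact (Finset.mem_range.1 hi).trans_le hn
  · simp only [Finset.card_range, nsmul_eq_mul]
    exact mul_le_mul_of_nonneg_right (by exact_mod_cast hn) hb

section

variable {a M : ℕ → ℕ → ℤ} {b β : ℤ}

theorem wp_dotProduct {n : ℕ} (hn : n < env.q * env.q) (hpos : σ .pos 0 = n)
    (hmat : Holds env.q (σ .mat) a) (hcur : Holds env.q (σ .cur) M)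
    (ha : ∀ r < env.q, ∀ c < env.q, |a r c| ≤ b) (hM : ∀ r < env.q, ∀ c < env.q, |M r c| ≤ β)
    (hbβ : env.q * (b * β) < 2 ^ env.width) (hqw : env.q ≤ env.width) :
    env.Wp dotProduct (env.q * 3 + 3) (fun σ' ω' => Frame [.acc, .idx] σ σ' ∧
      σ' .acc 0 = ∑ l ∈ Finset.range env.q, a (n / env.q) l * M l (n % env.q) ∧ ω' = ω) σ ω := by
  have hr := div_lt_of_lt_mul hn
  have hc := mod_lt_of_lt_mul hn
  have hb0 : 0 ≤ b := (abs_nonneg _).trans (ha _ hr _ hr)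
  have hβ0 : 0 ≤ β := (abs_nonneg _).trans (hM _ hr _ hr)
  refine Wp.mono (n := 1 + (env.q * (1 + 2) + 2)) (Wp.seq (wp_set (.const 0) (by simp) (by decide)
    (wp_forLoop (n := 1) (fun i σ' ω' => Frame [.acc, .idx] σ σ' ∧
      σ' .acc 0 = ∑ l ∈ Finset.range i, a (n / env.q) l * M l (n % env.q) ∧ ω' = ω) (by decide)
      (fun _ _ _ _ _ => Ev.partSize) (natCast_lt_two_pow hqw) ?_ ?_ fun _ _ h => h)))
      (by omega) (fun _ _ h => h)
  · refine ⟨(Frame.refl.upd ?_).upd ?_, ?_, rfl⟩ <;> simp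
  · rintro i hi σ' ω' ⟨hF, h1, rfl⟩ h2
    have hp : σ' .pos 0 = n := by rw [hF _ (by decide), hpos]
    refine wp_set (x := ∑ l ∈ Finset.range (i + 1), a (n / env.q) l * M l (n % env.q))
      ((Ev.add (.var _) (.mul
        (.arr _ (n := n / env.q * env.q + i) ((Ev.add (.mul (Ev.row hp) Ev.partSize)
          ((Ev.var _).cast h2)).cast (by push_cast; rfl)))
        (.arr _ (n := i * env.q + n % env.q) ((Ev.add (.mul ((Ev.var _).cast h2) Ev.partSize)
          (Ev.col hp)).cast (by push_cast; rfl))))).cast ?_) ?_ (by decide +kernel) ?_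
    · rw [h1, hF .mat (by decide), hF .cur (by decide), hmat.apply hr hi, hcur.apply hi hc,
        Finset.sum_range_succ]
    · refine lt_of_le_of_lt (abs_sum_range_le (by positivity) hi fun l hl => ?_) hbβ
      rw [abs_mul]
      exact mul_le_mul (ha _ hr _ hl) (hM _ hl _ hc) (abs_nonneg _) hb0
    · refine ⟨by simp [h2], (hF.upd ?_).upd ?_, ?_, rfl⟩ <;> simp

/-- The product goes to a separate array, since every entry of `cur` is still needed for later
positions. -/
theorem wp_mulMat (hmat : Holds env.q (σ .mat) a) (hcur : Holds env.q (σ .cur) M)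
    (ha : ∀ r < env.q, ∀ c < env.q, |a r c| ≤ b) (hM : ∀ r < env.q, ∀ c < env.q, |M r c| ≤ β)
    (hbβ : env.q * (b * β) < 2 ^ env.width) (hqw : env.q * env.q ≤ env.width)
    (hqs : env.q * env.q ≤ env.size) :
    env.Wp mulMat (env.q * env.q * (env.q * 3 + 6) + 2) (fun σ' ω' =>
      Frame [.acc, .idx, .next, .pos] σ σ' ∧ Holds env.q (σ' .next)
        (fun r c => ∑ l ∈ Finset.range env.q, a r l * M l c) ∧ ω' = ω) σ ω := by
  refine wp_forPos (n := env.q * 3 + 3 + 1) (fun n σ' ω' =>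
    Frame [.acc, .idx, .next, .pos] σ σ' ∧ (∀ i < n, σ' .next i =
      ∑ l ∈ Finset.range env.q, a (i / env.q) l * M l (i % env.q)) ∧ ω' = ω) hqw ?_ ?_
      fun _ _ h => h
  · exact ⟨Frame.refl.upd (by decide), by simp, rfl⟩
  · rintro i hi σ' ω' ⟨hF, h1, rfl⟩ h2
    have hr := div_lt_of_lt_mul hi
    have hc := mod_lt_of_lt_mul hi
    refine Wp.seq ((wp_dotProduct hi h2 (by rwa [hF _ (by decide)]) (by rwa [hF _ (by decide)]) ha hM
      hbβ ((Nat.le_mul_self _).trans hqw)).mono le_rfl ?_)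
    rintro σ'' ω'' ⟨hF', h3, rfl⟩
    have h4 : σ'' .pos 0 = i := by rw [hF' _ (by decide), h2]
    refine wp_setAt (a := i) ((Ev.var _).cast h4) ((Ev.var _).cast h3) (by omega) ?_ (by decide)
      (by decide) ⟨by rw [upd_of_ne _ (by decide), h4],
        ((hF.trans hF' (by decide)).upd (by decide)).upd (by decide), ?_, rfl⟩
    · have hb0 : 0 ≤ b := (abs_nonneg _).trans (ha _ hr _ hr)
      have hβ0 : 0 ≤ β := (abs_nonneg _).trans (hM _ hr _ hr)
      refine lt_of_le_of_lt (abs_sum_range_le (by positivity) le_rfl fun l hl => ?_) hbβ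
      rw [abs_mul]
      exact mul_le_mul (ha _ hr _ hl) (hM _ hl _ hc) (abs_nonneg _) hb0
    · intro j hj
      rw [upd_of_ne _ (by decide), upd_self, Function.update_apply]
      split_ifs with hji
      · rw [hji]
      · rw [hF' _ (by decide), h1 j (by omega)]

theorem wp_computeTrace (hnext : Holds env.q (σ .next) M)
    (hM : ∀ r < env.q, ∀ c < env.q, |M r c| ≤ β) (hβ : 0 ≤ β) (hqβ : env.q * β < 2 ^ env.width)
    (hqw : env.q ≤ env.width) :
    env.Wp computeTrace (env.q * 3 + 3) (fun σ' ω' => Frame [.trace, .idx] σ σ' ∧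
      σ' .trace 0 = ∑ r ∈ Finset.range env.q, M r r ∧ ω' = ω) σ ω := by
  refine Wp.mono (n := 1 + (env.q * (1 + 2) + 2)) (Wp.seq (wp_set (.const 0) (by simp) (by decide)
    (wp_forLoop (n := 1) (fun i σ' ω' => Frame [.trace, .idx] σ σ' ∧
      σ' .trace 0 = ∑ r ∈ Finset.range i, M r r ∧ ω' = ω) (by decide)
      (fun _ _ _ _ _ => Ev.partSize) (natCast_lt_two_pow hqw) ?_ ?_ fun _ _ h => h)))
      (by omega) (fun _ _ h => h)
  · refine ⟨(Frame.refl.upd ?_).upd ?_, ?_, rfl⟩ <;> simp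
  · rintro i hi σ' ω' ⟨hF, h1, rfl⟩ h2
    refine wp_set (x := ∑ r ∈ Finset.range (i + 1), M r r)
      ((Ev.add (.var _) (.arr _ (n := i * env.q + i) ((Ev.add (.mul ((Ev.var _).cast h2)
        Ev.partSize) ((Ev.var _).cast h2)).cast (by push_cast; rfl)))).cast ?_) ?_
        (by decide +kernel) ?_
    · rw [h1, hF .next (by decide), hnext.apply hi hi, Finset.sum_range_succ]
    · exact lt_of_le_of_lt (abs_sum_range_le hβ hi fun l hl => hM _ hl _ hl) hqβ
    · refine ⟨by simp [h2], (hF.upd ?_).upd ?_, ?_, rfl⟩ <;> simp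

/-- The invariant is that coefficient and matrix agree with `Leverrier.state` after `t` rounds.
Intermediate numbers of round `t` stay below `D ^ (t + 1)`. -/
theorem wp_leverrier (hmat : Holds env.q (σ .mat) a) (hb : 1 ≤ b)
    (ha : ∀ r < env.q, ∀ c < env.q, |a r c| ≤ b)
    (hw : (2 * env.q ^ 2 * b + 1) ^ (env.q + 1) < 2 ^ env.width)
    (hqw : env.q * env.q ≤ env.width) (hqs : env.q * env.q ≤ env.size) :
    env.Wp leverrier (env.q * env.q * 3 + 5 + env.q *
      (env.q * env.q * (env.q * 3 + 6) + 2 + (env.q * 3 + 3) + 1 + (env.q * env.q * 3 + 2) + 2))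
      (fun σ' ω' => Frame [.acc, .idx, .next, .pos, .trace, .coeff, .cur, .round] σ σ' ∧
        σ' .coeff 0 = (Leverrier.state env.q a env.q).2 ∧ ω' = ω) σ ω := by
  set D : ℤ := 2 * env.q ^ 2 * b + 1 with hD
  have hD1 : 1 ≤ D := by rw [hD]; nlinarith [sq_nonneg (env.q : ℤ)]
  have hqq : (env.q : ℤ) ≤ env.q ^ 2 := by exact_mod_cast Nat.le_self_pow two_ne_zero _
  have hDw : ∀ t ≤ env.q + 1, D ^ t < 2 ^ env.width := fun t ht =>
    (pow_le_pow_right₀ hD1 ht).trans_lt hw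
  -- The trace adds `q` dot products of `q` terms each, whence the two factors `q`.
  have hlarge : ∀ t < env.q, env.q * (env.q * (b * D ^ t)) ≤ D ^ (t + 1) := by
    intro t _
    have : 0 ≤ D ^ t := by positivity
    have : 0 ≤ env.q ^ 2 * b * D ^ t := by positivity
    rw [pow_succ, hD]
    nlinarith
  have hprod : ∀ t < env.q, env.q * (b * D ^ t) ≤ D ^ (t + 1) := by
    intro t ht
    have h1 : 0 ≤ env.q * (b * D ^ t) := by positivity
    exact (le_mul_of_one_le_left h1 (by exact_mod_cast (by omega : 1 ≤ env.q))).trans (hlarge t ht)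
  have hst := fun t => Leverrier.abs_state_le (q := env.q) a b hb ha t
  rw [← hD] at hst
  refine Wp.mono (Wp.seq (Wp.mono (wp_forPos_setAt (e := onDiag) (a := (Leverrier.state env.q a 0).1)
    (by decide) hqw hqs (fun r hr c hc => ((hst 0).1 r hr c hc).trans_lt (hDw 0 (by omega)))
    (by decide +kernel) fun i _ σ' _ h => Ev.onDiag h) le_rfl (Q' := env.Wp _
      (1 + (env.q * (env.q * env.q * (env.q * 3 + 6) + 2 +
        (env.q * 3 + 3 + (1 + (env.q * env.q * 3 + 2))) + 2) + 2)) _)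
    ?_)) (le_of_eq (by ring))
      fun _ _ h => h
  rintro σ₁ ω₁ ⟨hF₁, h0, hω⟩
  rw [hω]
  refine Wp.seq (wp_set (.const 1) (by simpa using hDw 0 (by omega)) (by decide)
    (wp_forLoop (fun t σ' ω' =>
      Frame [.acc, .idx, .next, .pos, .trace, .coeff, .cur, .round] σ σ' ∧
      σ' .coeff 0 = (Leverrier.state env.q a t).2 ∧
      Holds env.q (σ' .cur) (Leverrier.state env.q a t).1 ∧ ω' = ω) (by decide)
      (fun _ _ _ _ _ => Ev.partSize)
      (natCast_lt_two_pow ((Nat.le_mul_self _).trans hqw)) ?_ ?_ ?_))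
  · refine ⟨((Frame.refl.trans hF₁ (by decide)).upd (by decide)).upd (by decide), ?_, ?_, rfl⟩
    · simp [Leverrier.state]
    · rwa [upd_of_ne _ (by decide), upd_of_ne _ (by decide)]
  · rintro t ht σ' ω' ⟨hF, -, h1, rfl⟩ h2
    refine Wp.seq ((wp_mulMat (by rwa [hF _ (by decide)]) h1 ha (hst t).1
      ((hprod t ht).trans_lt (hDw _ (by omega))) hqw hqs).mono le_rfl ?_)
    rintro σ₂ ω₂ ⟨hF₂, h3, hω₂⟩
    rw [hω₂]
    refine Wp.seq ((wp_computeTrace (β := env.q * (b * D ^ t)) h3 (fun r hr c hc => ?_)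
      (by positivity) ((hlarge t ht).trans_lt (hDw _ (by omega)))
      ((Nat.le_mul_self _).trans hqw)).mono le_rfl ?_)
    · refine abs_sum_range_le (by positivity) le_rfl fun l hl => ?_
      rw [abs_mul]
      exact mul_le_mul (ha _ hr _ hl) ((hst t).1 _ hl _ hc) (abs_nonneg _) (by positivity)
    rintro σ₃ ω₃ ⟨hF₃, h4, hω₃⟩
    rw [hω₃]
    have h5 := ((hst (t + 1)).2).trans_lt (hDw _ (by omega))
    refine Wp.seq (wp_set (x := (Leverrier.state env.q a (t + 1)).2)
      ((Ev.div (.sub (.const 0) (.var _)) (.add (.var _) (.const 1))).cast ?_) h5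
      (by decide +kernel) ?_)
    · rw [h4, hF₃ _ (by decide), hF₂ _ (by decide), h2, zero_sub]
      rfl
    set σ₄ := σ₃.upd .coeff 0 (Leverrier.state env.q a (t + 1)).2 with hσ₄
    have hF₄ : Frame [.acc, .idx, .next, .pos, .trace, .coeff, .cur] σ' σ₄ :=
      ((Frame.refl.trans hF₂ (by decide)).trans hF₃ (by decide)).upd (by decide)
    refine (wp_forPos_setAt (a := (Leverrier.state env.q a (t + 1)).1) (by decide) hqw hqs
      (fun r hr c hc => ((hst (t + 1)).1 r hr c hc).trans_lt (hDw _ (by omega)))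
      (by decide +kernel) fun i hi σ₅ hF₅ h6 => (Ev.add (.arr _ (n := i) ((Ev.var _).cast h6))
        (.mul (Ev.onDiag h6) (.var _))).cast ?_).mono le_rfl ?_
    · rw [hF₅ .next (by decide), hF₅ .coeff (by decide), hσ₄, upd_of_ne _ (by decide),
        hF₃ _ (by decide), h3 i hi, upd_self, Function.update_self]
      rfl
    · rintro σ₅ ω₅ ⟨hF₅, h6, hω₅⟩
      refine ⟨?_, ((hF.trans hF₄ (by decide)).trans hF₅ (by decide)).upd (by decide), ?_, ?_, hω₅⟩
      · rw [hF₅ _ (by decide), hF₄ _ (by decide), h2]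
      · rw [upd_of_ne _ (by decide), hF₅ _ (by decide), hσ₄, upd_self, Function.update_self]
      · rwa [upd_of_ne _ (by decide)]
  · exact fun _ _ h => ⟨h.1, h.2.1, h.2.2.2⟩

end

end Env

end RAM

/-! ### The algorithm -/

namespace RAM

open State Env

/-- Add the contribution of one mask to the total. -/
def addMask : Prog :=
  .seq computeSigns (.seq buildMat (.seq leverrier
    (set .total (.op .add (var .total) (.op .mul (var .sign) (var .coeff))))))

/-- Compute the signed sum of the determinants for random weights. -/
def randomDetSum : Prog :=
  .seq drawWeights (.seq countMasks (.seq (set .total (.const 0))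
    (forLoop .mask (var .masks) addMask)))

namespace Env

variable {env : Env} {σ : State} {ω : List Bool}

variable (env) in
/-- The bounds on the lengths of the arrays and of the numbers suffice for the algorithm. -/
structure Large : Prop where
  m_size : env.m ≤ env.size
  signs_size : env.κ * env.q ≤ env.size
  mat_size : env.q * env.q ≤ env.size
  numBits_lt : env.numBits < env.width
  signs_lt : env.κ * env.q < env.width
  m_width : env.m ≤ env.width
  κ_width : env.κ ≤ env.width
  mat_width : env.q * env.q ≤ env.width
  entry_lt : ((env.m : ℤ) + 1) * 2 ^ env.numBits < 2 ^ env.width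
  total_lt : (2 : ℤ) ^ (env.κ * env.q) *
    (2 * env.q ^ 2 * ((env.m + 1) * 2 ^ env.numBits) + 1) ^ (env.q + 1) < 2 ^ env.width

variable (env) in
/-- The contribution of a mask. -/
def maskTerm (w : ℕ → ℤ) (X : ℕ) : ℤ :=
  (∏ i ∈ Finset.range (env.κ * env.q), maskSign X i) *
    (Leverrier.state env.q (env.matEntry w X env.m) env.q).2

variable (env) in
/-- The weights that are drawn with given coin tosses. -/
def weights (g : ℕ → Bool) (e : ℕ) : ℤ := drawn g (e * env.numBits) env.numBits

theorem abs_weights_le (g : ℕ → Bool) (e : ℕ) : |env.weights g e| ≤ 2 ^ env.numBits := by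
  rw [weights, abs_of_nonneg (drawn_nonneg _ _ _)]
  exact (drawn_lt _ _ _).le

variable (env) in
/-- A bound on the number of steps for a mask. -/
def maskSteps : ℕ :=
  env.κ * env.q * 5 + 4 + (env.q * env.q * 3 + 2 + (env.m * (env.κ * 3 + 6) + 2) +
    ((env.q * env.q * 3 + 5 + env.q *
      (env.q * env.q * (env.q * 3 + 6) + 2 + (env.q * 3 + 3) + 1 + (env.q * env.q * 3 + 2) + 2)) + 1))

variable (env) in
/-- A bound on the number of steps. -/
def totalSteps : ℕ :=
  env.m * (env.numBits * 5 + 7) + 2 + (env.κ * env.q * 3 + 3 +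
    (1 + (2 ^ (env.κ * env.q) * (env.maskSteps + 2) + 2)))

/-- Signs and matrices of the previous mask are overwritten; only the weights, the mask counters and
the running total survive. This keeps the space polynomial despite exponentially many masks. -/
theorem wp_addMask (h : env.Large) {w : ℕ → ℤ} (hwe : ∀ e < env.m, σ .weights e = w e)
    (hw : ∀ e < env.m, |w e| ≤ 2 ^ env.numBits) {X : ℕ} (hX : X < 2 ^ (env.κ * env.q))
    (hmask : σ .mask 0 = X) (htot : σ .total 0 = ∑ Y ∈ Finset.range X, env.maskTerm w Y) :
    env.Wp addMask env.maskSteps (fun σ' _ => σ' .mask 0 = X ∧ σ' .masks = σ .masks ∧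
      σ' .weights = σ .weights ∧
      σ' .total 0 = ∑ Y ∈ Finset.range (X + 1), env.maskTerm w Y) σ ω := by
  have hb1 : (1 : ℤ) ≤ 2 ^ env.numBits := one_le_pow₀ one_le_two
  have hent : ∀ Y r c, |env.matEntry w Y env.m r c| ≤ ((env.m : ℤ) + 1) * 2 ^ env.numBits :=
    fun Y r c => (abs_matEntry_le hw Y r c).trans (by nlinarith)
  have hb : (1 : ℤ) ≤ (env.m + 1) * 2 ^ env.numBits := by nlinarith
  refine Wp.seq ((wp_computeSigns hmask h.signs_lt h.signs_size).mono le_rfl ?_)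
  rintro σ₁ ω₁ ⟨hF₁, hs₁, hsg₁, -⟩
  refine Wp.seq ((wp_buildMat (w := w) (X := X) (fun e he => by rw [hF₁ _ (by decide), hwe e he]) hw
    (lt_of_le_of_lt (by nlinarith) h.entry_lt) hs₁ h.κ_width h.m_width h.mat_size
    h.mat_width).mono le_rfl ?_)
  rintro σ₂ ω₂ ⟨hF₂, hm₂, -⟩
  have htotal := h.total_lt
  set b : ℤ := (env.m + 1) * 2 ^ env.numBits
  set D : ℤ := 2 * env.q ^ 2 * b + 1 with hD
  have hD1 : 1 ≤ D := by rw [hD]; nlinarith [sq_nonneg (env.q : ℤ)]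
  refine Wp.seq ((wp_leverrier (b := b) hm₂ hb (fun r _ c _ => hent X r c)
    (lt_of_le_of_lt (le_mul_of_one_le_left (by positivity) (one_le_pow₀ one_le_two)) htotal)
    h.mat_width h.mat_size).mono le_rfl ?_)
  rintro σ₃ ω₃ ⟨hF₃, hc₃, -⟩
  have hterm : ∀ Y, |env.maskTerm w Y| ≤ D ^ (env.q + 1) := by
    intro Y
    rw [maskTerm, abs_mul, abs_prod_maskSign _ Y fun i => i, one_mul]
    exact (Leverrier.abs_state_le _ b hb (fun r _ c _ => hent Y r c) env.q).2.trans
      (pow_le_pow_right₀ hD1 (Nat.le_succ _))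
  refine wp_set (x := ∑ Y ∈ Finset.range (X + 1), env.maskTerm w Y)
    ((Ev.add (.var _) (.mul (.var _) (.var _))).cast ?_) ?_ (by decide +kernel) ⟨?_, ?_, ?_, ?_⟩
  · rw [hF₃ .total (by decide), hF₂ .total (by decide), hF₁ .total (by decide), htot, hc₃,
      hF₃ .sign (by decide), hF₂ .sign (by decide), hsg₁, Finset.sum_range_succ]
    rfl
  · refine lt_of_le_of_lt ((Finset.abs_sum_le_sum_abs _ _).trans
      ((Finset.sum_le_card_nsmul _ _ _ fun Y _ => hterm Y).trans ?_)) htotal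
    rw [Finset.card_range, nsmul_eq_mul]
    exact mul_le_mul_of_nonneg_right (by exact_mod_cast hX) (by positivity)
  · rw [upd_of_ne _ (by decide), hF₃ _ (by decide), hF₂ _ (by decide), hF₁ _ (by decide), hmask]
  · rw [upd_of_ne _ (by decide), hF₃ _ (by decide), hF₂ _ (by decide), hF₁ _ (by decide)]
  · rw [upd_of_ne _ (by decide), hF₃ _ (by decide), hF₂ _ (by decide), hF₁ _ (by decide)]
  · simp

/-- The weights are drawn once and shared by all masks; otherwise the determinants would not combine
into one value of the polynomial. -/
theorem wp_randomDetSum (h : env.Large) (g : ℕ → Bool) :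
    env.Wp randomDetSum env.totalSteps (fun σ' _ => σ' .total 0 =
      ∑ X ∈ Finset.range (2 ^ (env.κ * env.q)), env.maskTerm (env.weights g) X) σ
      (tosses g 0 (env.m * env.numBits)) := by
  refine Wp.seq ((wp_drawWeights g h.m_size h.numBits_lt h.m_width).mono le_rfl ?_)
  rintro σ₁ ω₁ ⟨-, hw⟩
  refine Wp.seq ((wp_countMasks h.signs_lt).mono le_rfl ?_)
  rintro σ₂ ω₂ ⟨hF₂, hm, -⟩
  refine Wp.seq (wp_set (.const 0) (by simp) (by decide) (wp_forLoop (fun X σ' _ =>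
    σ' .masks 0 = 2 ^ (env.κ * env.q) ∧ (∀ e < env.m, σ' .weights e = env.weights g e) ∧
    σ' .total 0 = ∑ Y ∈ Finset.range X, env.maskTerm (env.weights g) Y) (by decide +kernel)
    (fun X _ σ' ω' hI => (Ev.var _).cast (by rw [hI.1]; push_cast; rfl)) ?_ ?_ ?_ ?_))
  · push_cast
    exact pow_lt_pow_right₀ one_lt_two h.signs_lt
  · refine ⟨by simpa using hm, fun e he => ?_, by simp⟩
    rw [upd_of_ne _ (by decide), upd_of_ne _ (by decide), hF₂ _ (by decide), hw e he, weights]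
  · rintro X hX σ' ω' ⟨h1, h2, h3⟩ h4
    refine (wp_addMask h h2 (fun e _ => abs_weights_le g e) hX h4 h3).mono le_rfl ?_
    rintro σ'' ω'' ⟨h5, h6, h7, h8⟩
    refine ⟨h5, ?_, fun e he => ?_, ?_⟩
    · rw [upd_of_ne _ (by decide), h6, h1]
    · rw [upd_of_ne _ (by decide), h7, h2 e he]
    · rw [upd_of_ne _ (by decide), h8]
  · exact fun _ _ hI => hI.2.2

end Env

/-- The algorithm. -/
def matchingProg : Prog := .seq randomDetSum (.assign (.const 0) (var .total))

theorem Env.exec_matchingProg {env : Env} (h : env.Large) (g : ℕ → Bool) {μ : Mem} {σ : State}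
    (hμ : env.Rep μ σ) : ∃ μ' ω' t s, Exec matchingProg μ (tosses g 0 (env.m * env.numBits)) μ' ω' t s ∧
      t ≤ (env.totalSteps + 1) * stepTime env.width ∧ s ≤ totalSpace env.top env.width ∧
      μ' 0 = ∑ X ∈ Finset.range (2 ^ (env.κ * env.q)), env.maskTerm (env.weights g) X := by
  obtain ⟨μ₁, ω₁, t₁, s₁, σ₁, he₁, ht₁, hs₁, hr₁, hq⟩ := wp_randomDetSum h g μ hμ
  have hv : (var .total).eval μ₁ = σ₁ .total 0 := Ev.var _ μ₁ hr₁
  have h0 : ((Expr.const 0).eval μ₁).toNat = 0 := rfl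
  -- The answer overwrites `k` in cell `0`, on which all array addresses depend; this is harmless
  -- because the total is read before the write.
  obtain ⟨t₂, s₂, he₂, ht₂, hs₂⟩ := hr₁.bounded.assign (a := .const 0) (e := var .total) (ω := ω₁)
    (by decide) (by decide) (by rw [h0]; simp only [top, base]; omega)
    (by rw [hv, len_le_iff]; exact hr₁.abs_lt _ _)
  refine ⟨_, _, _, _, .seq he₁ he₂, by rw [add_mul, one_mul]; omega, max_le hs₁ hs₂, ?_⟩
  rw [h0, hv, hq]
  simp

end RAM

/-! ### The analysis of the algorithm -/

namespace KDM

open Finset RAM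

section Instance

variable {κ q : ℕ} (E : List (Fin (κ + 2) → Fin q))

theorem getD_flatMap_ofFn {k : ℕ} (E : List (Fin k → Fin q)) (e : ℕ) (he : e < E.length) (j : ℕ)
    (hj : j < k) :
    (E.flatMap fun e => List.ofFn fun j => (((e j : Fin q) : ℕ) : ℤ)).getD (e * k + j) 0 =
      ((E[e] ⟨j, hj⟩ : Fin q) : ℕ) := by
  induction E generalizing e with
  | nil => simp at he
  | cons a E ih =>
    rw [List.flatMap_cons]
    cases e with
    | zero =>
      rw [List.getD_append _ _ _ _ (by simpa using hj), List.getD_eq_getElem _ _ (by simpa using hj)]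
      simp
    | succ e =>
      rw [List.getD_append_right _ _ _ _ (by simp; nlinarith)]
      have := ih e (by simpa using he)
      rw [List.length_ofFn, show (e + 1) * k + j - k = e * k + j by
        rw [add_mul, one_mul]; omega, this]
      simp

theorem length_encode {k : ℕ} (E : List (Fin k → Fin q)) :
    (encode E).length = 3 + k * E.length := by
  simp [encode, List.length_flatMap, mul_comm, add_comm]
  omega

/-- The lengths of the arrays. -/
def arraySize (κ q m : ℕ) : ℕ := q * q + κ * q + m + 1

/-- The lengths of the numbers. -/
def numWidth (κ q m : ℕ) : ℕ :=
  (2 * q + m + ((κ + 2) * q + q) + 2) * (q + 1) + κ * q + κ + m + q * q + ((κ + 2) * q + q) + 3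

/-- The run of the algorithm on an instance. -/
def runEnv : Env where
  κ := κ
  q := q
  m := E.length
  size := arraySize κ q E.length
  width := numWidth κ q E.length
  input a := (encode E).getD a 0
  input_zero := rfl
  input_one := rfl
  input_two := rfl
  vertex e j := if h : e < E.length ∧ j < κ + 2 then ((E[e]'h.1) ⟨j, h.2⟩ : Fin q) else 0
  vertex_lt e he j hj := by rw [dif_pos ⟨he, hj⟩]; exact Fin.is_lt _
  input_edge e he j hj := by
    rw [dif_pos ⟨he, hj⟩, add_assoc, encode, List.getD_append_right _ _ _ _ (by simp)]
    simpa using getD_flatMap_ofFn E e he j hj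
  size_pos := Nat.succ_pos _
  width_pos := Nat.succ_pos _

theorem runEnv_vertex (e : Fin E.length) (j : Fin (κ + 2)) :
    (runEnv E).vertex e j = E.get e j := dif_pos ⟨e.2, j.2⟩

theorem two_mul_add_one_pow_lt (q m n : ℕ) :
    (2 * q ^ 2 * ((m + 1) * 2 ^ n) + 1) ^ (q + 1) ≤ 2 ^ ((2 * q + m + n + 2) * (q + 1)) := by
  rw [pow_mul]
  refine Nat.pow_le_pow_left ?_ _
  have h1 : q ^ 2 ≤ 2 ^ (2 * q) := by
    rw [mul_comm, pow_mul]
    exact Nat.pow_le_pow_left Nat.lt_two_pow_self.le 2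
  have h2 : m + 1 ≤ 2 ^ m := Nat.lt_two_pow_self
  have h3 : q ^ 2 * ((m + 1) * 2 ^ n) ≤ 2 ^ (2 * q) * (2 ^ m * 2 ^ n) := by gcongr
  have h4 : 2 ^ (2 * q + m + n + 2) = 4 * (2 ^ (2 * q) * (2 ^ m * 2 ^ n)) := by
    rw [pow_add, pow_add, pow_add]; ring
  have h5 : 1 ≤ 2 ^ (2 * q) * (2 ^ m * 2 ^ n) := Nat.one_le_iff_ne_zero.2 (by positivity)
  rw [h4]
  linarith

theorem runEnv_large : (runEnv E).Large where
  m_size := by simp only [runEnv, arraySize]; omega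
  signs_size := by simp only [runEnv, arraySize]; omega
  mat_size := by simp only [runEnv, arraySize]; omega
  numBits_lt := by simp only [runEnv, numWidth, Env.numBits]; omega
  signs_lt := by simp only [runEnv, numWidth]; omega
  m_width := by simp only [runEnv, numWidth]; omega
  κ_width := by simp only [runEnv, numWidth]; omega
  mat_width := by simp only [runEnv, numWidth]; omega
  entry_lt := by
    have h : E.length + 1 ≤ 2 ^ E.length := Nat.lt_two_pow_self
    have h2 : (E.length + 1) * 2 ^ (runEnv E).numBits < 2 ^ (runEnv E).width :=
      (Nat.mul_le_mul_right _ h).trans_lt (by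
        rw [← pow_add]
        exact Nat.pow_lt_pow_right one_lt_two (by simp only [runEnv, numWidth, Env.numBits]; omega))
    exact_mod_cast h2
  -- The first summand of `numWidth` is the exponent from `two_mul_add_one_pow_lt`, the summand `κ *
  -- q` accounts for the number of masks, and the rest makes the inequality strict.
  total_lt := by
    have h := two_mul_add_one_pow_lt q E.length (runEnv E).numBits
    have h2 : 2 ^ (κ * q) * (2 * q ^ 2 * ((E.length + 1) * 2 ^ (runEnv E).numBits) + 1) ^ (q + 1) <
        2 ^ (runEnv E).width :=
      (Nat.mul_le_mul_left _ h).trans_lt (by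
        rw [← pow_add]
        exact Nat.pow_lt_pow_right one_lt_two (by simp only [runEnv, numWidth, Env.numBits]; omega))
    exact_mod_cast h2

theorem abs_lt_of_mem_encode {z : ℤ} (hz : z ∈ encode E) : |z| < 2 ^ (runEnv E).width := by
  have key : ∀ n : ℕ, n ≤ (runEnv E).width → |(n : ℤ)| < 2 ^ (runEnv E).width := fun n hn => by
    rw [Nat.abs_cast]; exact natCast_lt_two_pow hn
  simp only [encode, List.cons_append, List.nil_append, List.mem_cons, List.mem_flatMap,
    List.mem_ofFn] at hz
  have hw : (runEnv E).width = numWidth κ q E.length := rfl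
  have h3 : q ≤ (κ + 2) * q := Nat.le_mul_of_pos_left _ (by omega)
  rcases hz with rfl | rfl | rfl | ⟨e, -, j, rfl⟩
  · exact key _ (by rw [hw, numWidth]; omega)
  · exact key _ (by rw [hw, numWidth]; omega)
  · exact key _ (by rw [hw, numWidth]; omega)
  · have := (e j).is_lt
    exact key _ (by rw [hw, numWidth]; omega)

theorem rep_initMem : (runEnv E).Rep (initMem (encode E)) fun _ _ => 0 := by
  have h0 : ∀ a, 3 + (κ + 2) * E.length ≤ a → initMem (encode E) a = 0 := fun a ha => by
    rw [initMem, List.toFinsupp_apply, List.getD_eq_default]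
    rwa [length_encode]
  refine ⟨fun a _ => List.toFinsupp_apply _ _, fun v n => h0 _ ?_, fun a ha => h0 a ?_, fun a => ?_⟩
  · simp only [Env.address, Env.base, runEnv]; omega
  · simp only [Env.top, Env.base, runEnv] at ha; omega
  · rw [len_le_iff, initMem, List.toFinsupp_apply]
    rcases lt_or_ge a (encode E).length with h | h
    · rw [List.getD_eq_getElem _ _ h]
      exact abs_lt_of_mem_encode E (List.getElem_mem h)
    · rw [List.getD_eq_default _ _ h, abs_zero]; positivity

/-- The bits of a mask, arranged by vertices. -/
def maskEquiv (κ q : ℕ) : Fin (2 ^ (κ * q)) ≃ (Fin κ × Fin q → Fin 2) :=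
  finFunctionFinEquiv.symm.trans (Equiv.arrowCongr finProdFinEquiv.symm (Equiv.refl _))

theorem bitSign_maskEquiv (X : Fin (2 ^ (κ * q))) (l : Fin κ) (v : Fin q) :
    (bitSign (maskEquiv κ q X (l, v)) : ℤ) = Env.maskSign X (l * q + v) := by
  have : (maskEquiv κ q X (l, v) : ℕ) = X / 2 ^ (l * q + v : ℕ) % 2 := by
    simp [maskEquiv, finFunctionFinEquiv_symm_apply_val, finProdFinEquiv, mul_comm, add_comm]
  rw [bitSign, this, Env.maskSign]

/-- Binary digits put masks and choices of signs in bijection. The recursion yields each determinant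
up to the factor `(-1) ^ q`, which is the same for all masks and so does not affect vanishing. -/
theorem sum_maskTerm (w : ℕ → ℤ) :
    ∑ X ∈ range (2 ^ (κ * q)), (runEnv E).maskTerm w X =
      (-1) ^ q * detSum E.get fun e => w e := by
  have hmat : ∀ X : Fin (2 ^ (κ * q)), (Matrix.of fun i j : Fin q =>
      (runEnv E).matEntry w X E.length i j) =
        signedMatrix E.get (fun e => w e) (maskEquiv κ q X) := by
    intro X
    ext i j
    rw [Matrix.of_apply, signedMatrix, Matrix.of_apply, Env.matEntry, Finset.sum_range]
    refine sum_congr rfl fun e _ => ?_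
    have h0 := runEnv_vertex E e 0
    have h1 := runEnv_vertex E e 1
    simp only [Fin.val_zero, Fin.val_one] at h0 h1
    rw [h0, h1]
    refine if_congr (by rw [Fin.ext_iff, Fin.ext_iff]) ?_ rfl
    rw [Env.edgeTerm, Finset.prod_range (n := (runEnv E).κ)]
    refine congrArg _ (prod_congr rfl fun l _ => ?_)
    have h := bitSign_maskEquiv X (l : Fin κ) (E.get e (Fin.succ (Fin.succ l)))
    rw [← runEnv_vertex] at h
    exact h.symm
  rw [Finset.sum_range, detSum, mul_sum, ← (maskEquiv κ q).sum_comp]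
  refine sum_congr rfl fun X _ => ?_
  rw [← hmat, Env.maskTerm]
  have h1 := Leverrier.state_last (q := q) ((runEnv E).matEntry w X E.length)
  have h2 : ∏ i ∈ range (κ * q), Env.maskSign X i = ∏ b, (bitSign (maskEquiv κ q X b) : ℤ) := by
    rw [Finset.prod_range, ← finProdFinEquiv.prod_comp]
    refine prod_congr rfl fun b _ => ?_
    rw [bitSign_maskEquiv]
    simp [finProdFinEquiv, mul_comm, add_comm]
  rw [← h2]
  refine Eq.trans (congrArg (_ * ·) h1) ?_
  show (∏ i ∈ range (κ * q), _) * _ = _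
  ring

end Instance

end KDM

/-! ### Probability of failure and running time -/

namespace KDM

open Finset RAM

/-- The top digits agree because the lower digits form a number below `2 ^ n`; then they cancel. -/
theorem drawn_congr {g g' : ℕ → Bool} {t n : ℕ} (h : Env.drawn g t n = Env.drawn g' t n) :
    ∀ b < n, g (t + b) = g' (t + b) := by
  induction n with
  | zero => simp
  | succ n ih =>
    rw [Env.drawn, Env.drawn, sum_range_succ, sum_range_succ, ← Env.drawn, ← Env.drawn] at h
    have h1 := Env.drawn_lt g t n
    have h2 := Env.drawn_lt g' t n
    have h3 := Env.drawn_nonneg g t n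
    have h4 := Env.drawn_nonneg g' t n
    have h5 : g (t + n) = g' (t + n) := by
      cases hg : g (t + n) <;> cases hg' : g' (t + n) <;> simp [hg, hg'] at h ⊢ <;> omega
    rw [h5, add_left_inj] at h
    intro b hb
    rcases Nat.lt_succ_iff_lt_or_eq.1 hb with hb | rfl
    · exact ih h b hb
    · exact h5

/-- The coin tosses as a sequence. -/
def extend {R : ℕ} (ω : Fin R → Bool) (i : ℕ) : Bool := if h : i < R then ω ⟨i, h⟩ else false

theorem tosses_extend {R : ℕ} (ω : Fin R → Bool) : Env.tosses (extend ω) 0 R = List.ofFn ω := by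
  refine List.ext_getElem (by simp [Env.tosses]) fun i h1 h2 => ?_
  have h : i < R := by simpa using h2
  simp [Env.tosses, extend, h]

/-- Distinct outcomes of the tosses give distinct weight vectors, and there are `2 ^ (m * n)` of
either. Hence the failing outcomes are at most as many as the zeros counted by Schwartz–Zippel. -/
theorem coinProb_le {κ q m n : ℕ} {E : Fin m → Fin (κ + 2) → Fin q} {σ : Equiv.Perm (Fin q)}
    {φ : Fin q → Fin m} (h : IsMatching E σ φ) (hn : (κ + 2) * q + q ≤ n) :
    coinProb {ω : Fin (m * n) → Bool | detSum E (fun e => Env.drawn (extend ω) (e * n) n) = 0} ≤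
      (2 : ℝ) ^ (-(((κ + 2) * q : ℕ) : ℝ)) := by
  classical
  set S : Finset ℤ := Finset.Ico 0 (2 ^ n) with hS
  have hcard : #S = 2 ^ n := by
    rw [hS, Int.card_Ico, sub_zero]
    exact_mod_cast Int.toNat_natCast (2 ^ n)
  set A := {ω : Fin (m * n) → Bool | detSum E (fun e => Env.drawn (extend ω) (e * n) n) = 0} with hA
  set Z := {f ∈ Fintype.piFinset fun _ : Fin m => S | detSum E f = 0} with hZ
  have h1 : A.ncard ≤ #Z := by
    rw [← Set.ncard_coe_finset]
    refine Set.ncard_le_ncard_of_injOn (fun ω (e : Fin m) => Env.drawn (extend ω) (e * n) n) ?_ ?_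
    · intro ω hω
      simp only [hZ, coe_filter, Set.mem_ofPred_eq, Fintype.mem_piFinset, hS, Finset.mem_Ico]
      exact ⟨fun e => ⟨Env.drawn_nonneg _ _ _, Env.drawn_lt _ _ _⟩, hω⟩
    · intro ω _ ω' _ heq
      funext i
      have hn0 : 0 < n := by
        rcases Nat.eq_zero_or_pos n with rfl | h
        · exact absurd i.2 (by simp)
        · exact h
      -- Toss `i` is digit `i % n` of the weight of edge `i / n`.
      have hi : (i : ℕ) / n < m := Nat.div_lt_of_lt_mul (i.2.trans_eq (mul_comm m n))
      have h2 := drawn_congr (congrFun heq ⟨i / n, hi⟩) (i % n) (Nat.mod_lt _ hn0)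
      simpa [extend, Nat.div_add_mod', i.2] using h2
  have h2 : (#Z / ((2 : ℝ) ^ n) ^ m) ≤ q / 2 ^ n := by
    have := card_detSum_eq_zero_le h S
    rw [hcard] at this
    have h3 : (((#Z / ((2 ^ n : ℕ) : ℚ≥0) ^ m : ℚ≥0)) : ℝ) ≤ ((q / (2 ^ n : ℕ) : ℚ≥0) : ℝ) := by
      exact_mod_cast this
    push_cast at h3
    exact h3
  calc coinProb A ≤ #Z / ((2 : ℝ) ^ n) ^ m := by
        rw [coinProb, ← pow_mul, mul_comm n m]
        gcongr
    _ ≤ q / 2 ^ n := h2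
    -- The `q` extra bits of each weight pay for the degree, through `q ≤ 2 ^ q`.
    _ ≤ 2 ^ q / 2 ^ ((κ + 2) * q + q) := by
        gcongr
        · exact_mod_cast Nat.lt_two_pow_self.le
        · exact one_le_two
    _ = (2 : ℝ) ^ (-(((κ + 2) * q : ℕ) : ℝ)) := by
        rw [Real.rpow_neg zero_le_two, Real.rpow_natCast, pow_add]
        field_simp

/-! ### Polynomial bounds in a single size parameter -/

section Bounds

variable {κ q : ℕ} (E : List (Fin (κ + 2) → Fin q)) {V : ℕ}
  (hV : V = (κ + 2) * q + (κ + 2) + E.length + 1)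
include hV

theorem stepTime_le : (runEnv E).width + 1 ≤ 30 * V ^ 2 ∧
    stepTime (runEnv E).width ≤ 7200000000 * V ^ 4 := by
  have hκq : κ * q + 2 * q = (κ + 2) * q := by ring
  have h1 : q + 1 ≤ V := by omega
  have h2 : 2 * q + E.length + ((κ + 2) * q + q) + 2 ≤ 7 * V := by omega
  have h3 : 1 ≤ V := by omega
  have h4 : V ≤ V ^ 2 := Nat.le_self_pow two_ne_zero V
  have h5 : q * q ≤ V ^ 2 := by rw [sq]; exact Nat.mul_le_mul (by omega) (by omega)
  have h6 := Nat.mul_le_mul h2 h1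
  have h7 : 7 * V * V = 7 * V ^ 2 := by ring
  have hw : (runEnv E).width + 1 ≤ 30 * V ^ 2 := by
    simp only [runEnv, numWidth]
    omega
  refine ⟨hw, ?_⟩
  calc stepTime (runEnv E).width ≤ 8 * (1000 * (30 * V ^ 2)) ^ 2 := by
        unfold stepTime maxWeight; gcongr
    _ = 7200000000 * V ^ 4 := by ring

/-- The fourth power stems from `q` matrix products with `q ^ 2` entries of `q` terms each. -/
theorem maskSteps_le : (runEnv E).maskSteps ≤ 100 * V ^ 4 := by
  have hκq : κ * q + 2 * q = (κ + 2) * q := by ring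
  have hq : q ≤ V := by omega
  have hκ : κ ≤ V := by omega
  have hm : E.length ≤ V := by omega
  have hN : κ * q ≤ V := by omega
  have h1 : 1 ≤ V := by omega
  have e1 : V ≤ V ^ 4 := Nat.le_self_pow (by norm_num) V
  have e2 : V ^ 2 ≤ V ^ 4 := Nat.pow_le_pow_right h1 (by norm_num)
  have e3 : V ^ 3 ≤ V ^ 4 := Nat.pow_le_pow_right h1 (by norm_num)
  calc (runEnv E).maskSteps ≤ V * 5 + 4 + (V * V * 3 + 2 + (V * (V * 3 + 6) + 2) +
    ((V * V * 3 + 5 + V * (V * V * (V * 3 + 6) + 2 + (V * 3 + 3) + 1 + (V * V * 3 + 2) + 2)) + 1)) := by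
        simp only [runEnv, Env.maskSteps]
        gcongr
    _ = 3 * V ^ 4 + 9 * V ^ 3 + 12 * V ^ 2 + 21 * V + 14 := by ring
    _ ≤ 100 * V ^ 4 := by omega

theorem totalSteps_le : (runEnv E).totalSteps + 1 ≤ 200 * V ^ 4 * 2 ^ (κ * q) := by
  have hκq : κ * q + 2 * q = (κ + 2) * q := by ring
  have hm : E.length ≤ V := by omega
  have hN : κ * q ≤ V := by omega
  have hb : (κ + 2) * q + q ≤ 2 * V := by omega
  have h1 : 1 ≤ V := by omega
  have e1 : V ≤ V ^ 4 := Nat.le_self_pow (by norm_num) V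
  have e2 : V ^ 2 ≤ V ^ 4 := Nat.pow_le_pow_right h1 (by norm_num)
  have h2 : 1 ≤ 2 ^ (κ * q) := Nat.one_le_two_pow
  calc (runEnv E).totalSteps + 1 ≤ V * (2 * V * 5 + 7) + 2 + (V * 3 + 3 +
        (1 + (2 ^ (κ * q) * (100 * V ^ 4 + 2) + 2))) + 1 := by
        have := maskSteps_le E hV
        simp only [Env.totalSteps, Env.numBits]
        simp only [runEnv] at this ⊢
        gcongr
    _ = 10 * V ^ 2 + 10 * V + 9 + (100 * V ^ 4 + 2) * 2 ^ (κ * q) := by ring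
    _ ≤ 29 * V ^ 4 * 2 ^ (κ * q) + (100 * V ^ 4 + 2) * 2 ^ (κ * q) := by
        have : 29 * V ^ 4 ≤ 29 * V ^ 4 * 2 ^ (κ * q) := Nat.le_mul_of_pos_right _ h2
        omega
    _ = (129 * V ^ 4 + 2) * 2 ^ (κ * q) := by ring
    _ ≤ 200 * V ^ 4 * 2 ^ (κ * q) := Nat.mul_le_mul_right _ (by omega)

theorem totalTime_le : ((runEnv E).totalSteps + 1) * stepTime (runEnv E).width ≤
    10 ^ 13 * V ^ 8 * 2 ^ (κ * q) := by
  refine (Nat.mul_le_mul (totalSteps_le E hV) (stepTime_le E hV).2).trans ?_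
  calc 200 * V ^ 4 * 2 ^ (κ * q) * (7200000000 * V ^ 4) =
        1440000000000 * (V ^ 8 * 2 ^ (κ * q)) := by ring
    _ ≤ 10 ^ 13 * (V ^ 8 * 2 ^ (κ * q)) := Nat.mul_le_mul_right _ (by norm_num)
    _ = 10 ^ 13 * V ^ 8 * 2 ^ (κ * q) := by ring

theorem totalSpace_le : totalSpace (runEnv E).top (runEnv E).width ≤ 10 ^ 13 * V ^ 8 := by
  have hκq : κ * q + 2 * q = (κ + 2) * q := by ring
  have h3 : 1 ≤ V := by omega
  have h4 : V ≤ V ^ 2 := Nat.le_self_pow two_ne_zero V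
  have h5 : q * q ≤ V ^ 2 := by rw [sq]; exact Nat.mul_le_mul (by omega) (by omega)
  have h6 : (κ + 2) * E.length ≤ V ^ 2 := by rw [sq]; exact Nat.mul_le_mul (by omega) (by omega)
  have htop : (runEnv E).top ≤ 100 * V ^ 2 := by
    simp only [Env.top, Env.base, runEnv, arraySize, numVars]
    omega
  obtain ⟨hw, hs⟩ := stepTime_le E hV
  have h8 : V ^ 4 ≤ V ^ 8 := Nat.pow_le_pow_right h3 (by norm_num)
  calc totalSpace (runEnv E).top (runEnv E).width
      ≤ 100 * V ^ 2 * (100 * V ^ 2 + 30 * V ^ 2) + 7200000000 * V ^ 4 := by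
        rw [totalSpace]
        refine Nat.add_le_add (Nat.mul_le_mul htop (by omega)) hs
    _ = 7200013000 * V ^ 4 := by ring
    _ ≤ 10 ^ 13 * V ^ 8 := Nat.mul_le_mul (by norm_num) h8

end Bounds

theorem decidedBy_matchingProg {k q : ℕ} (hk : 2 ≤ k) (E : List (Fin k → Fin q)) {B : ℕ}
    (hB : 10 ^ 13 * (k * q + k + E.length + 1) ^ 8 ≤ B) : DecidedBy matchingProg E B := by
  obtain ⟨κ, rfl⟩ : ∃ κ, k = κ + 2 := ⟨k - 2, by omega⟩
  set n := (runEnv E).numBits with hn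
  have key : ∀ ω : Fin (E.length * n) → Bool, ∃ μ' ω' t s,
      Exec matchingProg (initMem (encode E)) (List.ofFn ω) μ' ω' t s ∧
      t ≤ B * 2 ^ (κ * q) ∧ s ≤ B ∧
      μ' 0 = (-1) ^ q * detSum E.get fun e => Env.drawn (extend ω) (e * n) n := by
    intro ω
    obtain ⟨μ', ω', t, s, he, ht, hs, hv⟩ :=
      Env.exec_matchingProg (runEnv_large E) (extend ω) (rep_initMem E)
    refine ⟨μ', ω', t, s, ?_, ht.trans ((totalTime_le E rfl).trans (Nat.mul_le_mul_right _ hB)),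
      hs.trans ((totalSpace_le E rfl).trans hB), hv.trans (sum_maskTerm E _)⟩
    rw [← tosses_extend]
    exact he
  have hyes : ∀ ω : Fin (E.length * n) → Bool, AnswersYes matchingProg (encode E) (List.ofFn ω) ↔
      detSum E.get (fun e => Env.drawn (extend ω) (e * n) n) ≠ 0 := by
    intro ω
    obtain ⟨μ', ω', t, s, he, -, -, hv⟩ := key ω
    have h1 : μ' 0 ≠ 0 ↔ detSum E.get (fun e => Env.drawn (extend ω) (e * n) n) ≠ 0 := by
      rw [hv, mul_ne_zero_iff]
      exact and_iff_right (pow_ne_zero _ (by norm_num))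
    rw [← h1]
    refine ⟨?_, fun h => ⟨μ', ω', t, s, he, h⟩⟩
    rintro ⟨μ'', ω'', t', s', he', h⟩
    -- Any accepting run is the known run, by determinism.
    rwa [(he.deterministic he').1]
  refine ⟨E.length * n, fun ω => ?_, fun hno ω => ?_, fun h => ?_⟩
  · obtain ⟨μ', ω', t, s, he, ht, hs, -⟩ := key ω
    refine ⟨μ', ω', t, s, he, ?_, by exact_mod_cast hs⟩
    rw [show (((κ + 2) * q : ℕ) : ℝ) * (((κ + 2 : ℕ) : ℝ) - 2) / ((κ + 2 : ℕ) : ℝ) =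
      ((κ * q : ℕ) : ℝ) by push_cast; field_simp; ring, Real.rpow_natCast]
    exact_mod_cast ht
  · rw [hyes, not_not]
    exact detSum_eq_zero hno _
  · obtain ⟨σ, φ, hm⟩ := (hasPerfectMatching_iff E).1 h
    simp only [hyes, not_not]
    exact coinProb_le hm le_rfl

end KDM

theorem theorem1 :
    ∃ P : RAM.Prog,
      -- for every fixed `k`: bounds polynomial in `n = k * q`; the edges form a set
      (∀ k : ℕ, 2 ≤ k → ∃ p : Polynomial ℕ, ∀ (q : ℕ) (E : List (Fin k → Fin q)), E.Nodup →
        KDM.DecidedBy P E (p.eval (k * q))) ∧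
      -- uniformly in `k`, and for multisets of edges: bounds polynomial in `n`, `k` and `|E|`
      (∃ p : Polynomial ℕ, ∀ (k q : ℕ), 2 ≤ k → ∀ E : List (Fin k → Fin q),
        KDM.DecidedBy P E (p.eval (k * q + k + E.length))) := by
  refine ⟨RAM.matchingProg, fun k hk => ?_, ?_⟩
  -- For fixed `k` the summand `X ^ k` replaces the number of edges: distinct edges number at most
  -- `q ^ k ≤ (k * q) ^ k`.
  · refine ⟨Polynomial.C (10 ^ 13) * (Polynomial.X + Polynomial.C k + Polynomial.X ^ k + 1) ^ 8,
      fun q E hE => KDM.decidedBy_matchingProg hk E ?_⟩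
    have h1 : E.length ≤ q ^ k := by
      simpa using hE.length_le_card
    have h2 : q ^ k ≤ (k * q) ^ k := Nat.pow_le_pow_left (Nat.le_mul_of_pos_left _ (by omega)) _
    simp only [Polynomial.eval_mul, Polynomial.eval_pow, Polynomial.eval_add, Polynomial.eval_C,
      Polynomial.eval_X, Polynomial.eval_one]
    gcongr
    exact h1.trans h2
  · refine ⟨Polynomial.C (10 ^ 13) * (Polynomial.X + 1) ^ 8,
      fun k q hk E => KDM.decidedBy_matchingProg hk E ?_⟩
    simp only [Polynomial.eval_mul, Polynomial.eval_pow, Polynomial.eval_add, Polynomial.eval_C,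
      Polynomial.eval_X, Polynomial.eval_one]
    exact le_rfl
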